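/- Write points of $\mathbb C^2$ as $\lambda=(\lambda^1,\lambda^2)$, with $\|\lambda\|=\max_j|\lambda^j|$. Let $\varphi$ belong to the Schur class of the bidisk $\mathbb D^2$ (that is, $\varphi$ is analytic on $\mathbb D^2$ and $|\varphi|\le 1$ there), and let $\tau\in\partial(\mathbb D^2)$ be a $B$-point of $\varphi$, that is, $$\liminf_{\lambda\to\tau,\ \lambda\in\mathbb D^2}\frac{1-|\varphi(\lambda)|}{1-\|\lambda\|}<\infty .$$ A set $S\subset\mathbb D^2$ approaches $\tau$ nontangentially if $\tau\in\overline S$ and there is $c$ with $\|\tau-\lambda\|\le c\,(1-\|\lambda\|)$ for all $\lambda\in S$; a nontangential limit at $\tau$ is a common limit along all such sets $S$. Let $\varphi(\tau)$ denote the nontangential limit of $\varphi$ at $\tau$, let $$H_\tau=\{\delta\in\mathbb C^2:\ \operatorname{Re}(\overline{\tau^j}\delta^j)>0\ \text{ for each } j \text{ with } |\tau^j|=1\},$$ and, for $\delta\in H_\tau$, let $$D_{-\delta}\varphi(\tau)=\lim_{t\to0+}\frac{\varphi(\tau-t\delta)-\varphi(\tau)}{t}.$$ A model of $\varphi$ is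 a pair $(\mathcal M,u)$, where $\mathcal M=\mathcal M^1\oplus\mathcal M^2$ is an orthogonal direct sum of two complex Hilbert spaces and $u:\mathbb D^2\to\mathcal M$, $\lambda\mapsto u_\lambda=(u_\lambda^1,u_\lambda^2)$, is an analytic map such that, for all $\lambda,\mu\in\mathbb D^2$, $$1-\overline{\varphi(\mu)}\varphi(\lambda)=\sum_{j=1}^2\bigl(1-\overline{\mu^j}\lambda^j\bigr)\langle u_\lambda^j,u_\mu^j\rangle .$$ For $\lambda\in\mathbb C^2$ and $x=(x^1,x^2)\in\mathcal M$ write $\lambda x=(\lambda^1x^1,\lambda^2x^2)$. Let $Y_\tau$ be the set of weak limits in $\mathcal M$ of weakly convergent sequences $(u_{\lambda_n})$, where $(\lambda_n)$ is a sequence in $\mathbb D^2$ that tends to $\tau$ and for which $(1-|\varphi(\lambda_n)|)/(1-\|\lambda_n\|)$ is bounded. For $\delta\in H_\tau$ let $x_\tau(\delta)=(x_\tau^1(\delta),x_\tau^2(\delta))$ be the limit, in the norm of $\mathcal M$, of $u_{\tau-z\delta}$ as $\tau-z\delta\to\tau$ nontangentially ($z\in\mathbb C$). **Theorem.** The nontangential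 limit $\varphi(\tau)$ exists. For every $\delta\in H_\tau$ the directional derivative $D_{-\delta}\varphi(\tau)$ exists. As a function of $\delta$ it is analytic on $H_\tau$ and homogeneous of degree $1$: $D_{-z\delta}\varphi(\tau)=z\,D_{-\delta}\varphi(\tau)$ for all $z\in\mathbb C$ such that $\delta,z\delta\in H_\tau$. Moreover, for any model $(\mathcal M,u)$ of $\varphi$ and any $\delta\in H_\tau$, the limit $x_\tau(\delta)$ exists, and for any $y\in Y_\tau$ $$D_{-\delta}\varphi(\tau)=-\varphi(\tau)\,\langle\delta x_\tau(\delta),\tau y\rangle .$$ In particular, $$D_{-\delta}\varphi(\tau)=-\varphi(\tau)\sum_{|\tau^j|=1}\overline{\tau^j}\,\delta^j\,\|x_\tau^j(\delta)\|^2 .$$ -/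

import Mathlib

open Filter Topology

namespace Bidisk

noncomputable section

/-- Points of `ℂ²`; the norm of `Fin 2 → ℂ` is the maximum norm. -/
abbrev C2 : Type := Fin 2 → ℂ

/-- The open bidisk. -/
def bidisk : Set C2 := {z | ∀ j, ‖z j‖ < 1}

/-- The Schur class of the bidisk. Only the values of `φ` on the bidisk matter. -/
structure IsSchur (φ : C2 → ℂ) : Prop where
  analytic : AnalyticOnNhd ℂ φ bidisk
  norm_le_one : ∀ z ∈ bidisk, ‖φ z‖ ≤ 1

/-- The quotient `(1 - |φ(z)|) / (1 - ‖z‖)`. -/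
def juliaQuotient (φ : C2 → ℂ) (z : C2) : ℝ := (1 - ‖φ z‖) / (1 - ‖z‖)

/-- `τ` is a B-point of `φ`: a boundary point at which
`liminf (1 - |φ(z)|) / (1 - ‖z‖)`, as `z → τ` in the bidisk, is finite. -/
def IsBPoint (φ : C2 → ℂ) (τ : C2) : Prop :=
  τ ∈ frontier bidisk ∧
    liminf (fun z => (juliaQuotient φ z : EReal)) (𝓝[bidisk] τ) < ⊤

/-- The set `S` approaches `τ` nontangentially. -/
def ApproachesNT (S : Set C2) (τ : C2) : Prop :=
  S ⊆ bidisk ∧ τ ∈ closure S ∧ ∃ c : ℝ, ∀ z ∈ S, ‖τ - z‖ ≤ c * (1 - ‖z‖)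

/-- The filter of nontangential approach to `τ`: a function tends to `l` along it iff it tends
to `l` as `z → τ` along `S`, for every set `S` that approaches `τ` nontangentially. -/
def ntNhds (τ : C2) : Filter C2 :=
  ⨆ (S : Set C2) (_ : ApproachesNT S τ), 𝓝[S] τ

/-- The nontangential boundary value `φ(τ)`. -/
def ntValue (φ : C2 → ℂ) (τ : C2) : ℂ := limUnder (ntNhds τ) φ

/-- The directions `δ` that point out of the bidisk at `τ` (so that `-δ` points into it):
`Re (conj τʲ δʲ) > 0` for each `j` with `|τʲ| = 1`, no condition on the other coordinates. -/
def Htau (τ : C2) : Set C2 :=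
  {δ | ∀ j, ‖τ j‖ = 1 → 0 < (starRingEnd ℂ (τ j) * δ j).re}

/-- The difference quotient `(φ(τ + t v) - φ(τ)) / t`, where `φ(τ)` is the nontangential
boundary value. -/
def diffQuotient (φ : C2 → ℂ) (τ v : C2) (t : ℝ) : ℂ :=
  (φ (τ + (t : ℂ) • v) - ntValue φ τ) / (t : ℂ)

/-- The directional derivative `D_v φ(τ)`: the limit of the difference quotient as `t → 0+`. -/
def dirDeriv (φ : C2 → ℂ) (τ v : C2) : ℂ :=
  limUnder (𝓝[>] (0 : ℝ)) (diffQuotient φ τ v)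

section Model

variable {M : Fin 2 → Type*} [∀ j, NormedAddCommGroup (M j)] [∀ j, InnerProductSpace ℂ (M j)]

/-- `(M, u)` is a model of `φ`, where `M = M¹ ⊕ M²` is the Hilbert space direct sum. Mathlib's
inner product is linear in the second argument, so `⟨a, b⟩` is `inner ℂ b a`. -/
structure IsModel (φ : C2 → ℂ) (u : C2 → PiLp 2 M) : Prop where
  analytic : AnalyticOnNhd ℂ u bidisk
  identity : ∀ z ∈ bidisk, ∀ w ∈ bidisk,
    1 - starRingEnd ℂ (φ w) * φ z =
      ∑ j, (1 - starRingEnd ℂ (w j) * z j) * inner ℂ (u w j) (u z j)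

/-- A point of `ℂ²` acts on `M¹ ⊕ M²` coordinatewise. -/
def act (z : C2) (x : PiLp 2 M) : PiLp 2 M := WithLp.toLp 2 (fun j => z j • x j)

/-- The cluster set `Y_τ` of the model: weak limits of `u` along sequences in the bidisk that
tend to `τ` and along which `(1 - |φ|) / (1 - ‖·‖)` is bounded. -/
def Ytau (φ : C2 → ℂ) (u : C2 → PiLp 2 M) (τ : C2) : Set (PiLp 2 M) :=
  {y | ∃ z : ℕ → C2, (∀ n, z n ∈ bidisk) ∧ Tendsto z atTop (𝓝 τ) ∧
    (∃ C : ℝ, ∀ n, juliaQuotient φ (z n) ≤ C) ∧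
    ∀ v : PiLp 2 M, Tendsto (fun n => inner ℂ v (u (z n))) atTop (𝓝 (inner ℂ v y))}

/-- Nontangential approach to `τ` through points `τ - ζ δ`, `ζ ∈ ℂ`. -/
def ntNhdsAlong (τ δ : C2) : Filter C2 :=
  ntNhds τ ⊓ 𝓟 {z | ∃ ζ : ℂ, z = τ - ζ • δ}

/-- `x_τ(δ)`: the norm limit of `u` at `τ - ζ δ` as this point tends to `τ` nontangentially. -/
def xtau (u : C2 → PiLp 2 M) (τ δ : C2) : PiLp 2 M :=
  limUnder (ntNhdsAlong τ δ) u

end Model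

end

end Bidisk

namespace Bidisk

open ComplexConjugate Metric Set

/-! ### Schwarz–Pick lemma on the bidisk. -/

section SchwarzPick

/-! Boundary regularity comes from a Julia inequality at `τ`. By Schwarz–Pick, the pseudohyperbolic
distance of `φ z` and `φ w` is at most that of `z j` and `w j` for some `j` (`schwarzPick`). Letting
`w → τ` with bounded Julia quotient and `φ w → ω` gives `IsControlled.exists_julia`. On a
nontangential region this yields `|ω - φ z| ≤ K (1 - ‖z‖)`. Hence `ω` is the nontangential limit,
and it is the same for every controlled approach; moreover the difference quotients are bounded,
locally uniformly in the direction.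

If `δ j` is a positive multiple of `τ j` whenever `|τ j| = 1`, the points `τ - t δ` run along a
radius of an analytic disk inside the bidisk, and the one-variable Julia–Carathéodory theorem gives
the directional derivative. The quotients are holomorphic and locally bounded along complex lines of
directions, so Vitali's theorem, used in one coordinate at a time, carries convergence to all of
`Htau τ`. Homogeneity is a rescaling of `t` for positive factors and extends by the identity
theorem; it then reduces joint analyticity to one variable.

For a model, let one point of the model identity tend to `τ` while `u` tends weakly to `y`. The
result is `1 - conj ω * φ (τ - ζ δ) = ζ * boundaryForm τ δ y (u (τ - ζ δ))`
(`IsModel.boundary_identity`). Dividing by `ζ = t → 0` gives the formula as soon as `u` converges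
along the ray. Weak limits `x` exist by compactness. Taking `y = x` and comparing with the diagonal
model identity bounds weighted norms of `u` asymptotically by the weighted norm of `x`, so weak
convergence is norm convergence (`IsModel.tendsto_of_weakTendsto`). Positivity of the real part of
the form on the diagonal makes the limit unique (`IsModel.limit_unique`). -/

theorem norm_one_sub_conj_mul_sq (a b : ℂ) :
    ‖1 - conj a * b‖ ^ 2 = ‖b - a‖ ^ 2 + (1 - ‖a‖ ^ 2) * (1 - ‖b‖ ^ 2) := by
  simp only [← Complex.normSq_eq_norm_sq, Complex.normSq_apply, Complex.sub_re, Complex.sub_im,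
    Complex.mul_re, Complex.mul_im, Complex.conj_re, Complex.conj_im, Complex.one_re,
    Complex.one_im]
  ring

theorem one_sub_conj_mul_ne_zero {a b : ℂ} (ha : ‖a‖ < 1) (hb : ‖b‖ ≤ 1) :
    1 - conj a * b ≠ 0 := by
  intro h
  have h1 : ‖conj a * b‖ = 1 := by rw [← sub_eq_zero.mp h]; simp
  rw [norm_mul, RCLike.norm_conj] at h1
  nlinarith [norm_nonneg a, norm_nonneg b]

/-- The Blaschke factor that vanishes at `a`. -/
noncomputable def blaschke (a z : ℂ) : ℂ := (z - a) / (1 - conj a * z)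

theorem norm_blaschke_le_one {a z : ℂ} (ha : ‖a‖ < 1) (hz : ‖z‖ ≤ 1) : ‖blaschke a z‖ ≤ 1 := by
  have h := one_sub_conj_mul_ne_zero ha hz
  rw [blaschke, norm_div, div_le_one (norm_pos_iff.mpr h), ← sq_le_sq₀ (norm_nonneg _)
    (norm_nonneg _), norm_one_sub_conj_mul_sq]
  have h1 : ‖a‖ ^ 2 ≤ 1 := pow_le_one₀ (norm_nonneg _) ha.le
  have h2 : ‖z‖ ^ 2 ≤ 1 := pow_le_one₀ (norm_nonneg _) hz
  nlinarith

theorem norm_blaschke_lt_one {a z : ℂ} (ha : ‖a‖ < 1) (hz : ‖z‖ < 1) : ‖blaschke a z‖ < 1 := by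
  have h := one_sub_conj_mul_ne_zero ha hz.le
  rw [blaschke, norm_div, div_lt_one (norm_pos_iff.mpr h), ← sq_lt_sq₀ (norm_nonneg _)
    (norm_nonneg _), norm_one_sub_conj_mul_sq]
  have h1 : ‖a‖ ^ 2 < 1 := pow_lt_one₀ (norm_nonneg _) ha two_ne_zero
  have h2 : ‖z‖ ^ 2 < 1 := pow_lt_one₀ (norm_nonneg _) hz two_ne_zero
  nlinarith

theorem blaschke_neg_blaschke {a z : ℂ} (ha : ‖a‖ < 1) (hz : ‖z‖ ≤ 1) :
    blaschke (-a) (blaschke a z) = z := by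
  have h := one_sub_conj_mul_ne_zero ha hz
  have h2 := one_sub_conj_mul_ne_zero ha ha.le
  have h3 : (1 - conj a * z) + conj a * (z - a) ≠ 0 := by
    convert h2 using 1; ring
  have h4 : 1 - conj (-a) * ((z - a) / (1 - conj a * z)) ≠ 0 := by
    rw [map_neg]
    intro h5
    apply h3
    field_simp at h5
    linear_combination h5
  unfold blaschke
  rw [div_eq_iff h4, map_neg]
  have h5 := div_mul_cancel₀ (z - a) h
  linear_combination h5

theorem differentiableAt_blaschke {a z : ℂ} (ha : ‖a‖ < 1) (hz : ‖z‖ ≤ 1) :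
    DifferentiableAt ℂ (blaschke a) z := by
  have h := one_sub_conj_mul_ne_zero ha hz
  unfold blaschke
  fun_prop (disch := assumption)

theorem bidisk_eq_ball : bidisk = ball (0 : C2) 1 := by
  ext z
  simp [bidisk, pi_norm_lt_iff]

theorem mem_bidisk_iff_norm {z : C2} : z ∈ bidisk ↔ ‖z‖ < 1 := by
  rw [bidisk_eq_ball, mem_ball_zero_iff]

/-- Conjugating by Blaschke factors moves `w` and `φ w` to the origin, where the Schwarz lemma for
the maximum norm applies; `j` is a coordinate attaining that norm. Clearing denominators keeps the
inequality meaningful in the boundary limits taken later. -/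
theorem schwarzPick_of_norm_lt_one {φ : C2 → ℂ} (hd : DifferentiableOn ℂ φ bidisk)
    (hb : ∀ z ∈ bidisk, ‖φ z‖ < 1) {z w : C2} (hz : z ∈ bidisk) (hw : w ∈ bidisk) :
    ∃ j, (1 - ‖z j‖ ^ 2) * (1 - ‖w j‖ ^ 2) * ‖1 - conj (φ w) * φ z‖ ^ 2 ≤
      (1 - ‖φ z‖ ^ 2) * (1 - ‖φ w‖ ^ 2) * ‖1 - conj (w j) * z j‖ ^ 2 := by
  let b : C2 → C2 := fun v j => blaschke (-(w j)) (v j)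
  have hbmaps : MapsTo b bidisk bidisk := fun v hv j =>
    norm_blaschke_lt_one (by simpa using hw j) (hv j)
  let g : C2 → ℂ := fun v => blaschke (φ w) (φ (b v))
  have hg0 : g 0 = 0 := by
    have : b 0 = w := by ext j; simp [b, blaschke]
    simp [g, this, blaschke]
  have hbd : DifferentiableOn ℂ b bidisk := by
    rw [differentiableOn_pi]
    intro j v hv
    have h1 : DifferentiableAt ℂ (blaschke (-(w j))) (v j) :=
      differentiableAt_blaschke (by simpa using hw j) (hv j).le
    have h2 : DifferentiableAt ℂ (fun v : C2 => v j) v := by fun_prop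
    exact (DifferentiableAt.comp v h1 h2).differentiableWithinAt
  have hgd : DifferentiableOn ℂ g (ball 0 1) := by
    rw [← bidisk_eq_ball]
    intro v hv
    have h1 : DifferentiableAt ℂ (blaschke (φ w)) (φ (b v)) :=
      differentiableAt_blaschke (hb w hw) (hb _ (hbmaps hv)).le
    exact h1.comp_differentiableWithinAt v ((hd.comp hbd hbmaps) v hv)
  have hgm : MapsTo g (ball 0 1) (closedBall 0 1) := by
    intro v hv
    rw [← bidisk_eq_ball] at hv
    rw [mem_closedBall_zero_iff]
    exact norm_blaschke_le_one (hb w hw) (hb _ (hbmaps hv)).le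
  let v : C2 := fun j => blaschke (w j) (z j)
  have hv : v ∈ bidisk := fun j => norm_blaschke_lt_one (hw j) (hz j)
  have hbv : b v = z := by
    ext j
    exact blaschke_neg_blaschke (hw j) (hz j).le
  have key := Complex.norm_le_norm_of_mapsTo_ball hgd hgm hg0 (mem_bidisk_iff_norm.mp hv)
  obtain ⟨j, hj⟩ : ∃ j, ‖v‖ = ‖v j‖ := by
    by_contra! hne
    have h1 : ∀ j, ‖v j‖ < ‖v‖ := fun j => lt_of_le_of_ne (norm_le_pi_norm v j) (hne j).symm
    have h2 : 0 < ‖v‖ := (norm_nonneg _).trans_lt (h1 0)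
    exact lt_irrefl _ ((pi_norm_lt_iff h2).mpr h1)
  refine ⟨j, ?_⟩
  have hA := norm_pos_iff.mpr (one_sub_conj_mul_ne_zero (hb w hw) (hb z hz).le)
  have hB := norm_pos_iff.mpr (one_sub_conj_mul_ne_zero (hw j) (hz j).le)
  have key : ‖blaschke (φ w) (φ z)‖ ≤ ‖blaschke (w j) (z j)‖ := by
    have h1 := key.trans_eq hj
    rwa [show g v = blaschke (φ w) (φ z) by simp only [g, hbv]] at h1
  simp only [blaschke, norm_div] at key
  rw [div_le_div_iff₀ hA hB] at key
  have key2 := pow_le_pow_left₀ (by positivity) key 2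
  rw [mul_pow, mul_pow] at key2
  have e1 := norm_one_sub_conj_mul_sq (φ w) (φ z)
  have e2 := norm_one_sub_conj_mul_sq (w j) (z j)
  have f1 : (1 - ‖z j‖ ^ 2) * (1 - ‖w j‖ ^ 2) = ‖1 - conj (w j) * z j‖ ^ 2 - ‖z j - w j‖ ^ 2 := by
    rw [e2]; ring
  have f2 : (1 - ‖φ z‖ ^ 2) * (1 - ‖φ w‖ ^ 2) =
      ‖1 - conj (φ w) * φ z‖ ^ 2 - ‖φ z - φ w‖ ^ 2 := by
    rw [e1]; ring
  rw [f1, f2]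
  nlinarith

/-- The Schwarz-Pick lemma on the bidisk. -/
theorem schwarzPick {φ : C2 → ℂ} (hd : DifferentiableOn ℂ φ bidisk)
    (hb : ∀ z ∈ bidisk, ‖φ z‖ ≤ 1) {z w : C2} (hz : z ∈ bidisk) (hw : w ∈ bidisk) :
    ∃ j, (1 - ‖z j‖ ^ 2) * (1 - ‖w j‖ ^ 2) * ‖1 - conj (φ w) * φ z‖ ^ 2 ≤
      (1 - ‖φ z‖ ^ 2) * (1 - ‖φ w‖ ^ 2) * ‖1 - conj (w j) * z j‖ ^ 2 := by
  by_contra! hcon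
  -- If the inequality failed strictly for both `j`, it would still fail for `s φ` with `s < 1`
  -- close to `1`, a function of modulus less than `1`.
  have hev : ∀ᶠ s : ℝ in 𝓝[<] 1, ∀ j,
      (1 - ‖(s : ℂ) * φ z‖ ^ 2) * (1 - ‖(s : ℂ) * φ w‖ ^ 2) * ‖1 - conj (w j) * z j‖ ^ 2 <
      (1 - ‖z j‖ ^ 2) * (1 - ‖w j‖ ^ 2) * ‖1 - conj ((s : ℂ) * φ w) * ((s : ℂ) * φ z)‖ ^ 2 := by
    rw [eventually_all]
    intro j
    refine nhdsWithin_le_nhds (ContinuousAt.eventually_lt (x₀ := (1 : ℝ)) ?_ ?_ ?_)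
    · fun_prop
    · simp only [map_mul, Complex.conj_ofReal]; fun_prop
    · simpa using hcon j
  have hpos : ∀ᶠ s : ℝ in 𝓝[<] 1, 0 < s := nhdsWithin_le_nhds (lt_mem_nhds one_pos)
  obtain ⟨s, h1, hs0, hs1⟩ := (hev.and (hpos.and self_mem_nhdsWithin)).exists
  obtain ⟨j, hj⟩ := schwarzPick_of_norm_lt_one (φ := fun z => (s : ℂ) * φ z)
    (hd.const_mul _) (fun v hv => by
      have hs1' : s < 1 := hs1
      rw [norm_mul, Complex.norm_real, Real.norm_of_nonneg hs0.le]
      nlinarith [hb v hv, norm_nonneg (φ v)]) hz hw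
  exact absurd hj (not_le.mpr (h1 j))

/-- The Schwarz-Pick lemma on the disk. -/
theorem schwarzPick_disk {f : ℂ → ℂ} (hd : DifferentiableOn ℂ f (ball 0 1))
    (hb : ∀ z ∈ ball (0 : ℂ) 1, ‖f z‖ ≤ 1) {z w : ℂ} (hz : ‖z‖ < 1) (hw : ‖w‖ < 1) :
    (1 - ‖z‖ ^ 2) * (1 - ‖w‖ ^ 2) * ‖1 - conj (f w) * f z‖ ^ 2 ≤
      (1 - ‖f z‖ ^ 2) * (1 - ‖f w‖ ^ 2) * ‖1 - conj w * z‖ ^ 2 := by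
  have hm : MapsTo (fun v : C2 => v 0) bidisk (ball (0 : ℂ) 1) := fun v hv => by
    simpa using hv 0
  obtain ⟨j, hj⟩ := schwarzPick (φ := fun v => f (v 0)) (z := fun _ => z) (w := fun _ => w)
    (hd.comp (differentiable_apply 0).differentiableOn hm)
    (fun v hv => hb _ (hm hv)) (fun _ => hz) (fun _ => hw)
  exact hj

end SchwarzPick

/-! ### Julia's inequality and the nontangential limit. -/

section Julia

variable {φ : C2 → ℂ} {τ : C2} {ω : ℂ}

/-- A filter of points of the bidisk that converges to `τ`, along which the Julia quotient is
bounded and `φ` tends to `ω`. -/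
structure IsControlled (φ : C2 → ℂ) (τ : C2) (ω : ℂ) (V : Filter C2) : Prop where
  le : V ≤ 𝓝[bidisk] τ
  bounded : ∃ C : ℝ, ∀ᶠ z in V, juliaQuotient φ z ≤ C
  tendsto : Tendsto φ V (𝓝 ω)

theorem IsSchur.differentiableOn (hφ : IsSchur φ) : DifferentiableOn ℂ φ bidisk :=
  hφ.analytic.differentiableOn

theorem norm_eq_one_of_mem_frontier (hτ : τ ∈ frontier bidisk) : ‖τ‖ = 1 := by
  rw [bidisk_eq_ball, frontier_ball _ one_ne_zero] at hτ
  simpa using hτ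

theorem norm_apply_le_one (hτ : ‖τ‖ = 1) (j : Fin 2) : ‖τ j‖ ≤ 1 :=
  hτ ▸ norm_le_pi_norm τ j

theorem exists_norm_apply_eq_one (hτ : ‖τ‖ = 1) : ∃ j, ‖τ j‖ = 1 := by
  by_contra! h
  have h1 : ∀ j, ‖τ j‖ < 1 := fun j => lt_of_le_of_ne (norm_apply_le_one hτ j) (h j)
  exact hτ.not_lt ((pi_norm_lt_iff one_pos).mpr h1)

theorem norm_one_sub_conj_mul_of_norm_eq_one {a : ℂ} (ha : ‖a‖ = 1) (b : ℂ) :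
    ‖1 - conj a * b‖ = ‖a - b‖ := by
  have h : conj a * a = 1 := by
    rw [mul_comm, Complex.mul_conj, Complex.normSq_eq_norm_sq, ha]; simp
  rw [← h, ← mul_sub, norm_mul, RCLike.norm_conj, ha, one_mul]

theorem one_sub_norm_le_of_juliaQuotient_le {z : C2} (hz : z ∈ bidisk) {C : ℝ}
    (h : juliaQuotient φ z ≤ C) : 1 - ‖φ z‖ ≤ C * (1 - ‖z‖) := by
  rw [juliaQuotient, div_le_iff₀ (by linarith [mem_bidisk_iff_norm.mp hz])] at h
  exact h

namespace IsControlled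

variable {V : Filter C2}

theorem tendsto_id (hV : IsControlled φ τ ω V) : Tendsto (fun z : C2 => z) V (𝓝 τ) :=
  hV.le.trans nhdsWithin_le_nhds

theorem eventually_mem (hV : IsControlled φ τ ω V) : ∀ᶠ z in V, z ∈ bidisk :=
  hV.le self_mem_nhdsWithin

theorem tendsto_one_sub_norm (hV : IsControlled φ τ ω V) (hτ : ‖τ‖ = 1) :
    Tendsto (fun z : C2 => 1 - ‖z‖) V (𝓝 0) := by
  simpa [hτ] using hV.tendsto_id.norm.const_sub 1

theorem norm_eq_one [NeBot V] (hV : IsControlled φ τ ω V) (hφ : IsSchur φ) (hτ : ‖τ‖ = 1) :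
    ‖ω‖ = 1 := by
  obtain ⟨C, hC⟩ := hV.bounded
  have h1 : Tendsto (fun z => 1 - ‖φ z‖) V (𝓝 (1 - ‖ω‖)) := hV.tendsto.norm.const_sub 1
  have h2 : Tendsto (fun z : C2 => C * (1 - ‖z‖)) V (𝓝 0) := by
    simpa using (hV.tendsto_one_sub_norm hτ).const_mul C
  have h3 : Tendsto (fun z => 1 - ‖φ z‖) V (𝓝 0) := by
    refine tendsto_of_tendsto_of_tendsto_of_le_of_le' tendsto_const_nhds h2 ?_ ?_
    · filter_upwards [hV.eventually_mem] with z hz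
      linarith [hφ.norm_le_one z hz]
    · filter_upwards [hV.eventually_mem, hC] with z hz hzC
      exact one_sub_norm_le_of_juliaQuotient_le hz hzC
  linarith [tendsto_nhds_unique h1 h3]

/-- Julia's inequality on the bidisk. -/
theorem exists_julia [NeBot V] (hV : IsControlled φ τ ω V) (hφ : IsSchur φ) (hτ : ‖τ‖ = 1) :
    ∃ C : ℝ, 0 ≤ C ∧ ∀ z ∈ bidisk, ∃ j, ‖τ j‖ = 1 ∧
      (1 - ‖z j‖ ^ 2) * ‖1 - conj ω * φ z‖ ^ 2 ≤
        C * (1 - ‖φ z‖ ^ 2) * ‖1 - conj (τ j) * z j‖ ^ 2 := by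
  have hω := hV.norm_eq_one hφ hτ
  obtain ⟨C, hC⟩ := hV.bounded
  refine ⟨2 * max C 0, by positivity, fun z hz => ?_⟩
  have hzφ : 0 ≤ 1 - ‖φ z‖ ^ 2 := by
    have := pow_le_one₀ (n := 2) (norm_nonneg _) (hφ.norm_le_one z hz); linarith
  have hzj : ∀ j, 0 < 1 - ‖z j‖ ^ 2 := fun j => by
    have := pow_lt_one₀ (norm_nonneg _) (hz j) two_ne_zero; linarith
  -- The Schwarz–Pick coordinate depends on `w`; as there are only two, one of them occurs
  -- frequently along `V`.
  obtain ⟨j, hj⟩ : ∃ j, ∃ᶠ w in V,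
      (1 - ‖z j‖ ^ 2) * (1 - ‖w j‖ ^ 2) * ‖1 - conj (φ w) * φ z‖ ^ 2 ≤
      (1 - ‖φ z‖ ^ 2) * (1 - ‖φ w‖ ^ 2) * ‖1 - conj (w j) * z j‖ ^ 2 := by
    by_contra! hcon
    obtain ⟨w, hw1, hw⟩ := ((eventually_all.mpr hcon).and hV.eventually_mem).exists
    obtain ⟨j, hj⟩ := schwarzPick hφ.differentiableOn hφ.norm_le_one hz hw
    exact absurd hj (not_le.mpr (hw1 j))
  have tφ : Tendsto (fun w => ‖1 - conj (φ w) * φ z‖ ^ 2) V (𝓝 (‖1 - conj ω * φ z‖ ^ 2)) :=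
    (((((Complex.continuous_conj.tendsto ω).comp hV.tendsto).mul_const _).const_sub 1).norm.pow 2)
  have tj : ∀ j, Tendsto (fun w : C2 => w j) V (𝓝 (τ j)) := fun j =>
    ((continuous_apply j).tendsto τ).comp hV.tendsto_id
  have tτ : Tendsto (fun w : C2 => ‖1 - conj (w j) * z j‖ ^ 2) V
      (𝓝 (‖1 - conj (τ j) * z j‖ ^ 2)) :=
    (((((Complex.continuous_conj.tendsto _).comp (tj j)).mul_const _).const_sub 1).norm.pow 2)
  by_cases hτj : ‖τ j‖ = 1
  · refine ⟨j, hτj, ?_⟩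
    refine le_of_tendsto_of_tendsto_of_frequently (tφ.const_mul _) (tτ.const_mul _) ?_
    refine (hj.and_eventually (hC.and hV.eventually_mem)).mono ?_
    rintro w ⟨h1, h2, hw⟩
    have hw0 : 0 < 1 - ‖w‖ := by linarith [mem_bidisk_iff_norm.mp hw]
    have h3 := one_sub_norm_le_of_juliaQuotient_le hw h2
    have h4 : 1 - ‖φ w‖ ^ 2 ≤ 2 * max C 0 * (1 - ‖w‖) := by
      have h5 : C * (1 - ‖w‖) ≤ max C 0 * (1 - ‖w‖) :=
        mul_le_mul_of_nonneg_right (le_max_left _ _) hw0.le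
      nlinarith [hφ.norm_le_one w hw, norm_nonneg (φ w)]
    have h6 : 1 - ‖w‖ ≤ 1 - ‖w j‖ ^ 2 := by
      nlinarith [norm_le_pi_norm w j, hw j, norm_nonneg (w j)]
    refine le_of_mul_le_mul_right ?_ hw0
    calc (1 - ‖z j‖ ^ 2) * ‖1 - conj (φ w) * φ z‖ ^ 2 * (1 - ‖w‖)
        = ((1 - ‖z j‖ ^ 2) * ‖1 - conj (φ w) * φ z‖ ^ 2) * (1 - ‖w‖) := by ring
      _ ≤ ((1 - ‖z j‖ ^ 2) * ‖1 - conj (φ w) * φ z‖ ^ 2) * (1 - ‖w j‖ ^ 2) :=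
          mul_le_mul_of_nonneg_left h6 (mul_nonneg (hzj j).le (by positivity))
      _ = (1 - ‖z j‖ ^ 2) * (1 - ‖w j‖ ^ 2) * ‖1 - conj (φ w) * φ z‖ ^ 2 := by ring
      _ ≤ _ := h1
      _ = ((1 - ‖φ z‖ ^ 2) * ‖1 - conj (w j) * z j‖ ^ 2) * (1 - ‖φ w‖ ^ 2) := by ring
      _ ≤ ((1 - ‖φ z‖ ^ 2) * ‖1 - conj (w j) * z j‖ ^ 2) * (2 * max C 0 * (1 - ‖w‖)) :=
          mul_le_mul_of_nonneg_left h4 (mul_nonneg hzφ (by positivity))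
      _ = _ := by ring
  -- If `|τ j| < 1`, the limit inequality has right side `0` because `|ω| = 1`. This forces `φ z =
  -- ω`, and the claim is trivial at any unimodular coordinate `i`.
  · obtain ⟨i, hi⟩ := exists_norm_apply_eq_one hτ
    refine ⟨i, hi, ?_⟩
    have t1 : Tendsto (fun w : C2 => (1 - ‖z j‖ ^ 2) * (1 - ‖w j‖ ^ 2) *
        ‖1 - conj (φ w) * φ z‖ ^ 2) V
        (𝓝 ((1 - ‖z j‖ ^ 2) * (1 - ‖τ j‖ ^ 2) * ‖1 - conj ω * φ z‖ ^ 2)) :=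
      ((((tj j).norm.pow 2).const_sub 1).const_mul _).mul tφ
    have t2 : Tendsto (fun w : C2 => (1 - ‖φ z‖ ^ 2) * (1 - ‖φ w‖ ^ 2) *
        ‖1 - conj (w j) * z j‖ ^ 2) V
        (𝓝 ((1 - ‖φ z‖ ^ 2) * (1 - ‖ω‖ ^ 2) * ‖1 - conj (τ j) * z j‖ ^ 2)) :=
      (((hV.tendsto.norm.pow 2).const_sub 1).const_mul _).mul tτ
    have h1 := le_of_tendsto_of_tendsto_of_frequently t1 t2 hj
    rw [hω] at h1
    have h2 : 0 < 1 - ‖τ j‖ ^ 2 := by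
      have := pow_lt_one₀ (norm_nonneg _)
        (lt_of_le_of_ne (norm_apply_le_one hτ j) hτj) two_ne_zero
      linarith
    have h3 : ‖1 - conj ω * φ z‖ ^ 2 ≤ 0 := by
      by_contra! h4
      have := mul_pos (mul_pos (hzj j) h2) h4
      norm_num at h1
      linarith
    calc _ ≤ (1 - ‖z i‖ ^ 2) * 0 := mul_le_mul_of_nonneg_left h3 (hzj i).le
      _ = 0 := mul_zero _
      _ ≤ _ := by positivity

/-- On nontangential regions `φ` differs from its boundary value by at most a multiple of the
distance to the boundary. -/
theorem exists_norm_sub_le [NeBot V] (hV : IsControlled φ τ ω V) (hφ : IsSchur φ)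
    (hτ : ‖τ‖ = 1) (c : ℝ) :
    ∃ K : ℝ, 0 ≤ K ∧ ∀ z ∈ bidisk, ‖τ - z‖ ≤ c * (1 - ‖z‖) → ‖ω - φ z‖ ≤ K * (1 - ‖z‖) := by
  have hω := hV.norm_eq_one hφ hτ
  obtain ⟨C, hC0, hC⟩ := hV.exists_julia hφ hτ
  refine ⟨2 * C * c ^ 2, by positivity, fun z hz hzc => ?_⟩
  obtain ⟨j, hj, h⟩ := hC z hz
  rw [norm_one_sub_conj_mul_of_norm_eq_one hω, norm_one_sub_conj_mul_of_norm_eq_one hj] at h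
  have hzj : 0 < 1 - ‖z j‖ := by linarith [hz j]
  have hzz : 0 < 1 - ‖z‖ := by linarith [mem_bidisk_iff_norm.mp hz]
  have hle : 1 - ‖z‖ ≤ 1 - ‖z j‖ := by linarith [norm_le_pi_norm z j]
  have hc : 0 ≤ c := by
    by_contra! hc
    linarith [mul_neg_of_neg_of_pos hc hzz, norm_nonneg (τ - z)]
  have h1 : ‖τ j - z j‖ ≤ c * (1 - ‖z‖) := (norm_le_pi_norm (τ - z) j).trans hzc
  have h2 : ‖τ j - z j‖ ^ 2 ≤ c ^ 2 * (1 - ‖z‖) * (1 - ‖z j‖) := by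
    calc ‖τ j - z j‖ ^ 2 ≤ (c * (1 - ‖z‖)) ^ 2 := pow_le_pow_left₀ (norm_nonneg _) h1 2
      _ = c ^ 2 * (1 - ‖z‖) * (1 - ‖z‖) := by ring
      _ ≤ _ := mul_le_mul_of_nonneg_left hle (by positivity)
  have h3 : 1 - ‖φ z‖ ^ 2 ≤ 2 * ‖ω - φ z‖ := by
    have := norm_sub_norm_le ω (φ z)
    nlinarith [hφ.norm_le_one z hz, norm_nonneg (φ z)]
  have h0 : 0 ≤ 1 - ‖φ z‖ ^ 2 := by
    have := pow_le_one₀ (n := 2) (norm_nonneg _) (hφ.norm_le_one z hz); linarith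
  -- Julia's inequality is quadratic in `|ω - φ z|` on the left and, by `h3`, linear on the right,
  -- so one factor cancels.
  have h4 : ‖ω - φ z‖ ^ 2 ≤ 2 * C * c ^ 2 * (1 - ‖z‖) * ‖ω - φ z‖ := by
    refine le_of_mul_le_mul_right ?_ hzj
    calc ‖ω - φ z‖ ^ 2 * (1 - ‖z j‖) ≤ (1 - ‖z j‖ ^ 2) * ‖ω - φ z‖ ^ 2 := by
          rw [mul_comm]
          refine mul_le_mul_of_nonneg_right ?_ (by positivity)
          nlinarith [norm_nonneg (z j)]
      _ ≤ C * (1 - ‖φ z‖ ^ 2) * ‖τ j - z j‖ ^ 2 := h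
      _ ≤ C * (2 * ‖ω - φ z‖) * (c ^ 2 * (1 - ‖z‖) * (1 - ‖z j‖)) := by gcongr
      _ = _ := by ring
  rcases (norm_nonneg (ω - φ z)).eq_or_lt with h5 | h5
  · rw [← h5]; positivity
  · refine le_of_mul_le_mul_right ?_ h5
    rw [← sq]; exact h4

theorem tendsto_ntNhds [NeBot V] (hV : IsControlled φ τ ω V) (hφ : IsSchur φ)
    (hτ : ‖τ‖ = 1) : Tendsto φ (ntNhds τ) (𝓝 ω) := by
  rw [ntNhds, tendsto_iSup]
  intro S
  rw [tendsto_iSup]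
  rintro ⟨hS, -, c, hc⟩
  obtain ⟨K, -, hK⟩ := hV.exists_norm_sub_le hφ hτ c
  rw [tendsto_iff_norm_sub_tendsto_zero]
  have h1 : Tendsto (fun z : C2 => K * (1 - ‖z‖)) (𝓝[S] τ) (𝓝 0) := by
    have : Tendsto (fun z : C2 => K * (1 - ‖z‖)) (𝓝 τ) (𝓝 (K * (1 - ‖τ‖))) :=
      Continuous.tendsto (by fun_prop) τ
    rw [hτ, sub_self, mul_zero] at this
    exact this.mono_left nhdsWithin_le_nhds
  refine squeeze_zero' (Eventually.of_forall fun _ => norm_nonneg _) ?_ h1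
  filter_upwards [self_mem_nhdsWithin] with z hz
  rw [norm_sub_rev]
  exact hK z (hS hz) (hc z hz)

end IsControlled

/-- At a B-point there is a controlled ultrafilter. -/
theorem IsBPoint.exists_isControlled (hφ : IsSchur φ) (h : IsBPoint φ τ) :
    ∃ (ω : ℂ) (V : Ultrafilter C2), IsControlled φ τ ω V := by
  obtain ⟨C, hC1, -⟩ := EReal.lt_iff_exists_real_btwn.mp h.2
  have hf : ∃ᶠ z in 𝓝[bidisk] τ, juliaQuotient φ z < C :=
    (frequently_lt_of_liminf_lt (by isBoundedDefault) hC1).mono fun z hz =>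
      EReal.coe_lt_coe_iff.mp hz
  have hne : NeBot (𝓝[bidisk] τ ⊓ 𝓟 {z | juliaQuotient φ z < C}) :=
    frequently_mem_iff_neBot.mp hf
  let V := Ultrafilter.of (𝓝[bidisk] τ ⊓ 𝓟 {z | juliaQuotient φ z < C})
  have hV : (V : Filter C2) ≤ _ := Ultrafilter.of_le _
  have hV1 : (V : Filter C2) ≤ 𝓝[bidisk] τ := hV.trans inf_le_left
  obtain ⟨ω, -, hω⟩ := (isCompact_closedBall (0 : ℂ) 1).ultrafilter_le_nhds (V.map φ) (by
    rw [le_principal_iff, Ultrafilter.coe_map, mem_map]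
    filter_upwards [hV1 self_mem_nhdsWithin] with z hz
    simpa using hφ.norm_le_one z hz)
  refine ⟨ω, V, hV1, ⟨C, ?_⟩, hω⟩
  have : ∀ᶠ z in (V : Filter C2), juliaQuotient φ z < C :=
    hV (mem_inf_of_right (mem_principal_self _))
  exact this.mono fun z hz => hz.le

/-! ### Rays into the bidisk are nontangential. -/

section Rays

theorem eventually_norm_sub_smul_le_apply (hτ : ‖τ‖ = 1) {δ : C2} (hδ : δ ∈ Htau τ) (j : Fin 2) :
    ∃ κ : ℝ, 0 < κ ∧ ∀ᶠ p : C2 × ℝ in 𝓝 δ ×ˢ 𝓝[>] 0,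
      ‖τ j - (p.2 : ℂ) * p.1 j‖ ≤ 1 - κ * p.2 := by
  have hle : 𝓝 δ ×ˢ 𝓝[>] (0 : ℝ) ≤ 𝓝 (δ, 0) := by
    rw [nhds_prod_eq]; exact prod_mono le_rfl nhdsWithin_le_nhds
  by_cases hj : ‖τ j‖ = 1
  · have hρ := hδ j hj
    set ρ := (conj (τ j) * δ j).re
    -- For nearby directions and small `t` the squared modulus is at most `1 - ρ t + ρ t / 2`, which
    -- is at most `(1 - ρ t / 4) ^ 2`.
    refine ⟨ρ / 4, by positivity, ?_⟩
    have e1 : ∀ᶠ p : C2 × ℝ in 𝓝 (δ, 0), ρ / 2 < (conj (τ j) * p.1 j).re := by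
      refine ContinuousAt.eventually_lt (by fun_prop) (by fun_prop) ?_
      change ρ / 2 < ρ; linarith
    have e2 : ∀ᶠ p : C2 × ℝ in 𝓝 (δ, 0), p.2 * ‖p.1 j‖ ^ 2 < ρ / 2 := by
      refine ContinuousAt.eventually_lt (by fun_prop) (by fun_prop) ?_
      simpa using hρ
    have e3 : ∀ᶠ p : C2 × ℝ in 𝓝 (δ, 0), ρ / 4 * p.2 < 1 := by
      refine ContinuousAt.eventually_lt (by fun_prop) (by fun_prop) ?_
      simp
    have e4 : ∀ᶠ p : C2 × ℝ in 𝓝 δ ×ˢ 𝓝[>] 0, 0 < p.2 :=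
      tendsto_snd.eventually self_mem_nhdsWithin
    filter_upwards [hle e1, hle e2, hle e3, e4] with p h1 h2 h3 h4
    refine le_of_sq_le_sq ?_ (by linarith)
    have : ‖τ j - (p.2 : ℂ) * p.1 j‖ ^ 2 =
        ‖τ j‖ ^ 2 - 2 * p.2 * (conj (τ j) * p.1 j).re + p.2 ^ 2 * ‖p.1 j‖ ^ 2 := by
      simp only [← Complex.normSq_eq_norm_sq, Complex.normSq_apply, Complex.sub_re, Complex.sub_im,
        Complex.mul_re, Complex.mul_im, Complex.conj_re, Complex.conj_im, Complex.ofReal_re,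
        Complex.ofReal_im]
      ring
    rw [this, hj]
    nlinarith [mul_pos h4 (sub_pos.mpr h1), mul_pos h4 (sub_pos.mpr h2), sq_nonneg (ρ / 4 * p.2)]
  · refine ⟨1, one_pos, hle ?_⟩
    refine (ContinuousAt.eventually_lt (f := fun p : C2 × ℝ => ‖τ j - (p.2 : ℂ) * p.1 j‖)
      (g := fun p : C2 × ℝ => 1 - 1 * p.2) (by fun_prop) (by fun_prop) ?_).mono fun p => le_of_lt
    simpa using lt_of_le_of_ne (norm_apply_le_one hτ j) hj

/-- Points `τ - t δ` stay at a distance of order `t` from the boundary, locally uniformly in the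
direction `δ`. -/
theorem eventually_norm_sub_smul_le (hτ : ‖τ‖ = 1) {δ : C2} (hδ : δ ∈ Htau τ) :
    ∃ κ : ℝ, 0 < κ ∧ ∀ᶠ p : C2 × ℝ in 𝓝 δ ×ˢ 𝓝[>] 0,
      0 < p.2 ∧ ‖τ - (p.2 : ℂ) • p.1‖ ≤ 1 - κ * p.2 := by
  choose κ hκ0 hκ using eventually_norm_sub_smul_le_apply hτ hδ
  refine ⟨min (κ 0) (κ 1), lt_min (hκ0 0) (hκ0 1), ?_⟩
  have e4 : ∀ᶠ p : C2 × ℝ in 𝓝 δ ×ˢ 𝓝[>] 0, 0 < p.2 :=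
    tendsto_snd.eventually self_mem_nhdsWithin
  filter_upwards [eventually_all.mpr hκ, e4] with p hp h4
  refine ⟨h4, ?_⟩
  have key : ∀ j, ‖(τ - (p.2 : ℂ) • p.1) j‖ ≤ 1 - min (κ 0) (κ 1) * p.2 := by
    intro j
    have h1 : min (κ 0) (κ 1) ≤ κ j := by
      fin_cases j
      · exact min_le_left _ _
      · exact min_le_right _ _
    have h2 : min (κ 0) (κ 1) * p.2 ≤ κ j * p.2 := mul_le_mul_of_nonneg_right h1 h4.le
    have h3 := hp j
    simp only [Pi.sub_apply, Pi.smul_apply, smul_eq_mul]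
    linarith
  exact (pi_norm_le_iff_of_nonneg ((norm_nonneg _).trans (key 0))).mpr key

theorem norm_sub_le_of_norm_sub_smul_le {δ : C2} {t κ : ℝ} (ht : 0 < t) (hκ : 0 < κ)
    (h : ‖τ - (t : ℂ) • δ‖ ≤ 1 - κ * t) :
    τ - (t : ℂ) • δ ∈ bidisk ∧
      ‖τ - (τ - (t : ℂ) • δ)‖ ≤ ‖δ‖ / κ * (1 - ‖τ - (t : ℂ) • δ‖) := by
  refine ⟨mem_bidisk_iff_norm.mpr (by nlinarith [mul_pos hκ ht]), ?_⟩
  rw [sub_sub_cancel, norm_smul, Complex.norm_real, Real.norm_of_nonneg ht.le]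
  calc t * ‖δ‖ = ‖δ‖ / κ * (κ * t) := by field_simp
    _ ≤ _ := mul_le_mul_of_nonneg_left (by linarith) (by positivity)

theorem tendsto_ray (hτ : ‖τ‖ = 1) {δ : C2} (hδ : δ ∈ Htau τ) :
    Tendsto (fun t : ℝ => τ - (t : ℂ) • δ) (𝓝[>] 0) (ntNhdsAlong τ δ) := by
  obtain ⟨κ, hκ0, hκ⟩ := eventually_norm_sub_smul_le hτ hδ
  have hκ' := Eventually.self_of_nhds hκ.curry
  have hlim : Tendsto (fun t : ℝ => τ - (t : ℂ) • δ) (𝓝[>] 0) (𝓝 τ) := by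
    have h : Continuous fun t : ℝ => τ - (t : ℂ) • δ := by fun_prop
    simpa using (h.tendsto 0).mono_left nhdsWithin_le_nhds
  refine tendsto_inf.mpr ⟨?_, tendsto_principal.mpr (Eventually.of_forall fun t => ⟨t, rfl⟩)⟩
  let S : Set C2 := {z | z ∈ bidisk ∧ ‖τ - z‖ ≤ ‖δ‖ / κ * (1 - ‖z‖)}
  have hev : ∀ᶠ t : ℝ in 𝓝[>] 0, τ - (t : ℂ) • δ ∈ S :=
    hκ'.mono fun t ht => norm_sub_le_of_norm_sub_smul_le ht.1 hκ0 ht.2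
  have hS : ApproachesNT S τ :=
    ⟨fun z hz => hz.1, mem_closure_of_tendsto hlim hev, _, fun z hz => hz.2⟩
  exact (tendsto_nhdsWithin_iff.mpr ⟨hlim, hev⟩).mono_right (le_iSup₂_of_le S hS le_rfl)

theorem neBot_ntNhdsAlong (hτ : ‖τ‖ = 1) {δ : C2} (hδ : δ ∈ Htau τ) :
    NeBot (ntNhdsAlong τ δ) := (tendsto_ray hτ hδ).neBot

theorem self_mem_Htau (τ : C2) : τ ∈ Htau τ := fun j hj => by
  rw [mul_comm, Complex.mul_conj, Complex.normSq_eq_norm_sq, hj]; simp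

theorem neBot_ntNhds (hτ : ‖τ‖ = 1) : NeBot (ntNhds τ) :=
  (neBot_ntNhdsAlong hτ (self_mem_Htau τ)).mono inf_le_left

end Rays

theorem IsControlled.ntValue_eq {V : Filter C2} [NeBot V] (hV : IsControlled φ τ ω V)
    (hφ : IsSchur φ) (hτ : ‖τ‖ = 1) : ntValue φ τ = ω :=
  haveI := neBot_ntNhds hτ
  (hV.tendsto_ntNhds hφ hτ).limUnder_eq

end Julia

/-! ### The one-variable Julia–Carathéodory theorem, radially. -/

section JuliaCaratheodory

variable {f : ℂ → ℂ} {ω : ℂ} {K : ℝ}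

theorem exists_ultrafilter_limits (hb : ∀ z ∈ ball (0 : ℂ) 1, ‖f z‖ ≤ 1) (hω : ‖ω‖ = 1)
    (hK : ∀ᶠ r : ℝ in 𝓝[<] 1, ‖ω - f r‖ ≤ K * (1 - r)) {U : Ultrafilter ℝ}
    (hU : (U : Filter ℝ) ≤ 𝓝[<] 1) :
    ∃ (P : ℂ) (Q : ℝ),
      Tendsto (fun r : ℝ => (1 - conj ω * f r) / ((1 - r : ℝ) : ℂ)) U (𝓝 P) ∧
      Tendsto (fun r : ℝ => (1 - ‖f r‖) / (1 - r)) U (𝓝 Q) ∧ 0 ≤ Q ∧ Q ≤ P.re := by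
  have e1 : ∀ᶠ r : ℝ in U, r < 1 := hU self_mem_nhdsWithin
  have e2 : ∀ᶠ r : ℝ in U, 0 < r := hU (nhdsWithin_le_nhds (lt_mem_nhds one_pos))
  have e3 : ∀ᶠ r : ℝ in U, (0 ≤ (1 - ‖f r‖) / (1 - r)) ∧
      (1 - ‖f r‖) / (1 - r) ≤ ((1 - conj ω * f r) / ((1 - r : ℝ) : ℂ)).re ∧
      ‖(1 - conj ω * f r) / ((1 - r : ℝ) : ℂ)‖ ≤ K := by
    filter_upwards [e1, e2, hU hK] with r h1 h2 h3
    have h4 : 0 < 1 - r := by linarith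
    have h5 : ‖f r‖ ≤ 1 := hb _ (by simpa [abs_of_pos h2] using h1)
    refine ⟨div_nonneg (by linarith) h4.le, ?_, ?_⟩
    · rw [Complex.div_ofReal_re]
      gcongr
      have := Complex.re_le_norm (conj ω * f r)
      rw [norm_mul, RCLike.norm_conj, hω, one_mul] at this
      rw [Complex.sub_re, Complex.one_re]
      linarith
    · rw [norm_div, Complex.norm_real, Real.norm_of_nonneg h4.le, div_le_iff₀ h4,
        norm_one_sub_conj_mul_of_norm_eq_one hω]
      exact h3
  obtain ⟨P, -, hP⟩ := (isCompact_closedBall (0 : ℂ) K).ultrafilter_le_nhds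
    (U.map fun r : ℝ => (1 - conj ω * f r) / ((1 - r : ℝ) : ℂ)) (by
      rw [le_principal_iff, Ultrafilter.coe_map, mem_map]
      exact e3.mono fun r hr => mem_closedBall_zero_iff.mpr hr.2.2)
  obtain ⟨Q, -, hQ⟩ := (isCompact_Icc (a := (0 : ℝ)) (b := K)).ultrafilter_le_nhds
    (U.map fun r : ℝ => (1 - ‖f r‖) / (1 - r)) (by
      rw [le_principal_iff, Ultrafilter.coe_map, mem_map]
      exact e3.mono fun r hr => ⟨hr.1, hr.2.1.trans ((Complex.re_le_norm _).trans hr.2.2)⟩)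
  have hP' : Tendsto (fun r : ℝ => (1 - conj ω * f r) / ((1 - r : ℝ) : ℂ)) U (𝓝 P) := hP
  have hQ' : Tendsto (fun r : ℝ => (1 - ‖f r‖) / (1 - r)) U (𝓝 Q) := hQ
  exact ⟨P, Q, hP', hQ', ge_of_tendsto hQ' (e3.mono fun r hr => hr.1),
    le_of_tendsto_of_tendsto hQ' ((Complex.continuous_re.tendsto _).comp hP')
      (e3.mono fun r hr => hr.2.1)⟩

/-- Divide Schwarz–Pick for the radii `x` and `r` by `1 - r`, let `r → 1` along `V`, then divide by
the powers of `1 - x` and let `x → 1` along `U`: the limit is `|P|² ≤ Q Q'`. Since `Q ≤ |P|`, one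
factor cancels. -/
theorem norm_limit_le (hd : DifferentiableOn ℂ f (ball 0 1))
    (hb : ∀ z ∈ ball (0 : ℂ) 1, ‖f z‖ ≤ 1) (hω : ‖ω‖ = 1) {U V : Filter ℝ} [NeBot U] [NeBot V]
    (hU : U ≤ 𝓝[<] 1) (hV : V ≤ 𝓝[<] 1) (hfU : Tendsto (fun r : ℝ => f r) U (𝓝 ω))
    (hfV : Tendsto (fun r : ℝ => f r) V (𝓝 ω)) {P : ℂ} {Q Q' : ℝ}
    (hP : Tendsto (fun r : ℝ => (1 - conj ω * f r) / ((1 - r : ℝ) : ℂ)) U (𝓝 P))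
    (hQ : Tendsto (fun r : ℝ => (1 - ‖f r‖) / (1 - r)) U (𝓝 Q))
    (hQ' : Tendsto (fun r : ℝ => (1 - ‖f r‖) / (1 - r)) V (𝓝 Q'))
    (hQP : Q ≤ P.re) (hQ0' : 0 ≤ Q') : ‖P‖ ≤ Q' := by
  have mem : ∀ r : ℝ, 0 < r → r < 1 → (r : ℂ) ∈ ball (0 : ℂ) 1 := fun r h0 h1 => by
    simpa [abs_of_pos h0] using h1
  have ev : ∀ W : Filter ℝ, W ≤ 𝓝[<] 1 → ∀ᶠ r : ℝ in W, 0 < r ∧ r < 1 := fun W hW =>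
    Eventually.and (hW (nhdsWithin_le_nhds (lt_mem_nhds one_pos))) (hW self_mem_nhdsWithin)
  have tid : ∀ W : Filter ℝ, W ≤ 𝓝[<] 1 → Tendsto (fun r : ℝ => r) W (𝓝 1) := fun W hW =>
    hW.trans nhdsWithin_le_nhds
  have step : ∀ x : ℝ, 0 < x → x < 1 →
      (1 + x) * ‖(1 - conj ω * f x) / ((1 - x : ℝ) : ℂ)‖ ^ 2 ≤
        (1 + ‖f x‖) * ((1 - ‖f x‖) / (1 - x)) * Q' := by
    intro x hx0 hx1
    have hx : 0 < 1 - x := by linarith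
    have tr : Tendsto (fun r : ℝ => (r : ℂ)) V (𝓝 1) :=
      (Complex.continuous_ofReal.tendsto 1).comp (tid V hV)
    have t1 : Tendsto (fun r : ℝ => (1 - x ^ 2) * (1 + r) * ‖1 - conj (f r) * f x‖ ^ 2) V
        (𝓝 ((1 - x ^ 2) * (1 + 1) * ‖1 - conj ω * f x‖ ^ 2)) :=
      (((tid V hV).const_add 1).const_mul _).mul
        (((((Complex.continuous_conj.tendsto ω).comp hfV).mul_const _).const_sub 1).norm.pow 2)
    have t2 : Tendsto (fun r : ℝ => (1 - ‖f x‖ ^ 2) * ((1 + ‖f r‖) * ((1 - ‖f r‖) / (1 - r))) *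
        (1 - r * x) ^ 2) V (𝓝 ((1 - ‖f x‖ ^ 2) * ((1 + ‖ω‖) * Q') * (1 - 1 * x) ^ 2)) :=
      (((hfV.norm.const_add 1).mul hQ').const_mul _).mul
        ((((tid V hV).mul_const x).const_sub 1).pow 2)
    have h1 := le_of_tendsto_of_tendsto t1 t2 (by
      filter_upwards [ev V hV] with r hr
      have hr' : 0 < 1 - r := by linarith
      have h := schwarzPick_disk hd hb (z := (x : ℂ)) (w := (r : ℂ))
        (by simpa using mem x hx0 hx1) (by simpa using mem r hr.1 hr.2)
      have e : ‖1 - conj (r : ℂ) * (x : ℂ)‖ ^ 2 = (1 - r * x) ^ 2 := by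
        rw [Complex.conj_ofReal, ← Complex.ofReal_mul, ← Complex.ofReal_one, ← Complex.ofReal_sub,
          Complex.norm_real, Real.norm_eq_abs, sq_abs]
      rw [e, Complex.norm_real, Complex.norm_real, Real.norm_eq_abs, Real.norm_eq_abs, sq_abs,
        sq_abs] at h
      refine le_of_mul_le_mul_right ?_ hr'
      calc _ = (1 - x ^ 2) * (1 - r ^ 2) * ‖1 - conj (f r) * f x‖ ^ 2 := by ring
        _ ≤ _ := h
        _ = _ := by field_simp; ring)
    rw [hω] at h1
    rw [norm_div, Complex.norm_real, Real.norm_of_nonneg hx.le, div_pow]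
    have h2 : (1 + x) * ‖1 - conj ω * f x‖ ^ 2 ≤ (1 + ‖f x‖) * (1 - ‖f x‖) * Q' * (1 - x) := by
      refine le_of_mul_le_mul_right ?_ (show 0 < 2 * (1 - x) by linarith)
      calc _ = (1 - x ^ 2) * (1 + 1) * ‖1 - conj ω * f x‖ ^ 2 := by ring
        _ ≤ _ := h1
        _ = _ := by ring
    calc _ = (1 + x) * ‖1 - conj ω * f x‖ ^ 2 / (1 - x) ^ 2 := by ring
      _ ≤ (1 + ‖f x‖) * (1 - ‖f x‖) * Q' * (1 - x) / (1 - x) ^ 2 := by gcongr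
      _ = _ := by field_simp
  have t3 : Tendsto (fun x : ℝ => (1 + x) * ‖(1 - conj ω * f x) / ((1 - x : ℝ) : ℂ)‖ ^ 2) U
      (𝓝 ((1 + 1) * ‖P‖ ^ 2)) := ((tid U hU).const_add 1).mul (hP.norm.pow 2)
  have t4 : Tendsto (fun x : ℝ => (1 + ‖f x‖) * ((1 - ‖f x‖) / (1 - x)) * Q') U
      (𝓝 ((1 + ‖ω‖) * Q * Q')) := ((hfU.norm.const_add 1).mul hQ).mul_const Q'
  have h := le_of_tendsto_of_tendsto t3 t4 ((ev U hU).mono fun x hx => step x hx.1 hx.2)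
  rw [hω] at h
  have h5 : Q ≤ ‖P‖ := hQP.trans (Complex.re_le_norm P)
  rcases (norm_nonneg P).eq_or_lt with h6 | h6
  · rw [← h6]; exact hQ0'
  · refine le_of_mul_le_mul_left ?_ h6
    nlinarith [mul_le_mul_of_nonneg_right h5 hQ0']

/-- The Julia-Carathéodory theorem for radial approach. -/
theorem exists_tendsto_radial (hd : DifferentiableOn ℂ f (ball 0 1))
    (hb : ∀ z ∈ ball (0 : ℂ) 1, ‖f z‖ ≤ 1) (hω : ‖ω‖ = 1)
    (hK : ∀ᶠ r : ℝ in 𝓝[<] 1, ‖ω - f r‖ ≤ K * (1 - r)) :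
    ∃ d : ℂ, Tendsto (fun r : ℝ => (f r - ω) / ((1 - r : ℝ) : ℂ)) (𝓝[<] 1) (𝓝 d) := by
  have hf : Tendsto (fun r : ℝ => f r) (𝓝[<] 1) (𝓝 ω) := by
    rw [tendsto_iff_norm_sub_tendsto_zero]
    have h1 : Tendsto (fun r : ℝ => K * (1 - r)) (𝓝[<] 1) (𝓝 0) := by
      have h : Continuous fun r : ℝ => K * (1 - r) := by fun_prop
      simpa using (h.tendsto 1).mono_left nhdsWithin_le_nhds
    refine squeeze_zero' (Eventually.of_forall fun _ => norm_nonneg _) ?_ h1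
    filter_upwards [hK] with r hr
    rwa [norm_sub_rev]
  obtain ⟨P₀, Q₀, hP₀, hQ₀, hQ₀0, hQP₀⟩ :=
    exists_ultrafilter_limits hb hω hK (Ultrafilter.of_le (𝓝[<] (1 : ℝ)))
  have key : Tendsto (fun r : ℝ => (1 - conj ω * f r) / ((1 - r : ℝ) : ℂ)) (𝓝[<] 1)
      (𝓝 (Q₀ : ℂ)) := by
    rw [tendsto_iff_ultrafilter]
    intro U hU
    obtain ⟨P, Q, hP, hQ, hQ0, hQP⟩ := exists_ultrafilter_limits hb hω hK hU
    have hU₀ := Ultrafilter.of_le (𝓝[<] (1 : ℝ))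
    have h1 : ‖P‖ ≤ Q₀ := norm_limit_le hd hb hω hU hU₀ (hf.mono_left hU) (hf.mono_left hU₀)
      hP hQ hQ₀ hQP hQ₀0
    have h2 : ‖P₀‖ ≤ Q := norm_limit_le hd hb hω hU₀ hU (hf.mono_left hU₀) (hf.mono_left hU)
      hP₀ hQ₀ hQ hQP₀ hQ0
    have h3 := Complex.re_le_norm P
    have h4 := Complex.re_le_norm P₀
    -- The chain `|P| ≤ Q₀ ≤ Re P₀ ≤ |P₀| ≤ Q ≤ Re P ≤ |P|` collapses to equalities, so every
    -- ultrafilter limit is the real number `Q₀`.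
    have h5 : P.re = ‖P‖ := by linarith
    have h6 : P = (Q₀ : ℂ) := by
      have h7 := (Complex.nonneg_iff.mp (Complex.re_eq_norm.mp h5)).2
      apply Complex.ext
      · rw [Complex.ofReal_re]; linarith
      · rw [Complex.ofReal_im, ← h7]
    rw [← h6]
    exact hP
  refine ⟨-ω * Q₀, (key.const_mul (-ω)).congr fun r => ?_⟩
  have h : ω * conj ω = 1 := by
    rw [Complex.mul_conj, Complex.normSq_eq_norm_sq, hω]; simp
  rw [← mul_div_assoc]
  congr 1
  linear_combination f r * h

end JuliaCaratheodory

/-! ### Vitali's convergence theorem through ultrafilters. -/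

section Vitali

variable {ι : Type*} {l : Filter ι} {F : ι → ℂ → ℂ} {Ω : Set ℂ}

/-- The family `F` is eventually holomorphic and bounded near each point of `Ω`. -/
def EventuallyLocallyBounded (l : Filter ι) (F : ι → ℂ → ℂ) (Ω : Set ℂ) : Prop :=
  ∀ z₀ ∈ Ω, ∃ r : ℝ, 0 < r ∧ ∃ C : ℝ, ∀ᶠ i in l,
    DifferentiableOn ℂ (F i) (ball z₀ r) ∧ ∀ z ∈ ball z₀ r, ‖F i z‖ ≤ C

/-- Schwarz lemma for a function vanishing to second order. The constant is `2C` for the increment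
of `g` plus `2C` for the linear term. Only `C` and `r` enter, so the estimate survives pointwise
limits. -/
theorem norm_sub_sub_deriv_mul_le {g : ℂ → ℂ} {z₀ : ℂ} {r C : ℝ} (hr : 0 < r)
    (hd : DifferentiableOn ℂ g (ball z₀ r)) (hb : ∀ z ∈ ball z₀ r, ‖g z‖ ≤ C) :
    ‖deriv g z₀‖ ≤ 2 * C / r ∧ ∀ z ∈ ball z₀ r,
      ‖g z - g z₀ - deriv g z₀ * (z - z₀)‖ ≤ 4 * C * (‖z - z₀‖ / r) ^ 2 := by
  have h0 : z₀ ∈ ball z₀ r := mem_ball_self hr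
  have hm : ∀ z ∈ ball z₀ r, ‖g z - g z₀‖ ≤ 2 * C := fun z hz => by
    linarith [norm_sub_le (g z) (g z₀), hb z hz, hb z₀ h0]
  have hder : ‖deriv g z₀‖ ≤ 2 * C / r := Complex.norm_deriv_le_div_of_mapsTo_ball hd
    (fun z hz => by rw [mem_closedBall, dist_eq_norm]; exact hm z hz) hr
  refine ⟨hder, fun z hz => ?_⟩
  let h : ℂ → ℂ := fun z => g z - g z₀ - deriv g z₀ * (z - z₀)
  have hh0 : h z₀ = 0 := by simp [h]
  have key := Complex.dist_le_mul_div_pow_of_mapsTo_ball_of_isLittleO (f := h) (c := z₀) (z := z)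
    (R₁ := r) (R₂ := 4 * C) (n := 1) ?_ ?_ ?_ hz
  · rw [hh0, dist_zero_right, dist_eq_norm] at key
    exact key
  · exact (hd.sub_const _).sub (by fun_prop)
  · intro w hw
    rw [hh0, mem_closedBall_zero_iff]
    have h1 : ‖deriv g z₀ * (w - z₀)‖ ≤ 2 * C := by
      rw [norm_mul]
      have h2 : ‖w - z₀‖ ≤ r := by rw [← dist_eq_norm]; exact (mem_ball.mp hw).le
      calc _ ≤ 2 * C / r * r := by gcongr; exact (norm_nonneg _).trans hder
        _ = 2 * C := by field_simp
    linarith [norm_sub_le (g w - g z₀) (deriv g z₀ * (w - z₀)), hm w hw]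
  · have h1 := (hd.differentiableAt (isOpen_ball.mem_nhds h0)).hasDerivAt.isLittleO
    simp only [hh0, sub_zero, pow_one]
    refine (h1.norm_right).congr_left fun w => ?_
    simp only [h, smul_eq_mul]
    ring

theorem differentiableAt_of_tendsto_ultrafilter {U : Ultrafilter ι} {G : ℂ → ℂ} {z₀ : ℂ} {r C : ℝ}
    (hr : 0 < r) (hF : ∀ᶠ i in U, DifferentiableOn ℂ (F i) (ball z₀ r) ∧
      ∀ z ∈ ball z₀ r, ‖F i z‖ ≤ C)
    (hG : ∀ z ∈ ball z₀ r, Tendsto (fun i => F i z) U (𝓝 (G z))) : DifferentiableAt ℂ G z₀ := by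
  have hb := hF.mono fun i hi => norm_sub_sub_deriv_mul_le hr hi.1 hi.2
  obtain ⟨d, -, hd⟩ := (isCompact_closedBall (0 : ℂ) (2 * C / r)).ultrafilter_le_nhds
    (U.map fun i => deriv (F i) z₀) (by
      rw [le_principal_iff, Ultrafilter.coe_map, mem_map]
      exact hb.mono fun i hi => mem_closedBall_zero_iff.mpr hi.1)
  have hd' : Tendsto (fun i => deriv (F i) z₀) U (𝓝 d) := hd
  have hle : ∀ z ∈ ball z₀ r, ‖G z - G z₀ - d * (z - z₀)‖ ≤ 4 * C * (‖z - z₀‖ / r) ^ 2 := by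
    intro z hz
    refine le_of_tendsto (((hG z hz).sub (hG z₀ (mem_ball_self hr))).sub
      (hd'.mul_const (z - z₀))).norm (hb.mono fun i hi => hi.2 z hz)
  have : HasDerivAt G d z₀ := by
    rw [hasDerivAt_iff_isLittleO]
    refine Asymptotics.IsBigO.trans_isLittleO (g := fun z => ‖z - z₀‖ ^ 2) ?_
      (Asymptotics.isLittleO_pow_sub_sub z₀ one_lt_two)
    refine Asymptotics.IsBigO.of_bound (4 * C / r ^ 2) ?_
    filter_upwards [ball_mem_nhds z₀ hr] with z hz
    rw [norm_pow, norm_norm, smul_eq_mul, mul_comm (z - z₀) d]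
    refine (hle z hz).trans_eq ?_
    rw [div_pow]
    ring
  exact this.differentiableAt

theorem EventuallyLocallyBounded.differentiableOn [NeBot l]
    (hF : EventuallyLocallyBounded l F Ω) (hΩ : IsOpen Ω) {G : ℂ → ℂ}
    (hG : ∀ z ∈ Ω, Tendsto (fun i => F i z) l (𝓝 (G z))) : DifferentiableOn ℂ G Ω := by
  intro z₀ hz₀
  obtain ⟨r, hr, C, h⟩ := hF z₀ hz₀
  obtain ⟨s, hs, hsΩ⟩ := Metric.isOpen_iff.mp hΩ z₀ hz₀
  have hU := Ultrafilter.of_le l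
  have hsub1 : ball z₀ (min r s) ⊆ ball z₀ r := ball_subset_ball (min_le_left _ _)
  have hsub2 : ball z₀ (min r s) ⊆ ball z₀ s := ball_subset_ball (min_le_right _ _)
  exact (differentiableAt_of_tendsto_ultrafilter (U := Ultrafilter.of l) (lt_min hr hs)
    ((h.filter_mono hU).mono fun i hi => ⟨hi.1.mono hsub1, fun z hz => hi.2 z (hsub1 hz)⟩)
    fun z hz => (hG z (hsΩ (hsub2 hz))).mono_left hU).differentiableWithinAt

/-- Vitali's convergence theorem. -/
theorem EventuallyLocallyBounded.exists_tendsto [NeBot l] (hF : EventuallyLocallyBounded l F Ω)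
    (hΩ : IsOpen Ω) (hΩc : IsPreconnected Ω) {z₀ : ℂ} (hz₀ : z₀ ∈ Ω)
    (hfreq : ∃ᶠ z in 𝓝[≠] z₀, ∃ d, Tendsto (fun i => F i z) l (𝓝 d)) {z : ℂ} (hz : z ∈ Ω) :
    ∃ d, Tendsto (fun i => F i z) l (𝓝 d) := by
  have hex : ∀ U : Ultrafilter ι, (U : Filter ι) ≤ l → ∀ z ∈ Ω,
      ∃ d, Tendsto (fun i => F i z) U (𝓝 d) := by
    intro U hU z hz
    obtain ⟨r, hr, C, h⟩ := hF z hz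
    obtain ⟨d, -, hd⟩ := (isCompact_closedBall (0 : ℂ) C).ultrafilter_le_nhds
      (U.map fun i => F i z) (by
        rw [le_principal_iff, Ultrafilter.coe_map, mem_map]
        exact hU (h.mono fun i hi => mem_closedBall_zero_iff.mpr (hi.2 z (mem_ball_self hr))))
    exact ⟨d, hd⟩
  have hlim : ∀ U : Ultrafilter ι, (U : Filter ι) ≤ l → ∀ z ∈ Ω,
      Tendsto (fun i => F i z) U (𝓝 (limUnder (U : Filter ι) fun i => F i z)) :=
    fun U hU z hz => tendsto_nhds_limUnder (hex U hU z hz)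
  have han : ∀ U : Ultrafilter ι, (U : Filter ι) ≤ l →
      AnalyticOnNhd ℂ (fun z => limUnder (U : Filter ι) fun i => F i z) Ω := fun U hU =>
    (EventuallyLocallyBounded.differentiableOn (l := (U : Filter ι)) (fun z hz => by
      obtain ⟨r, hr, C, h⟩ := hF z hz
      exact ⟨r, hr, C, hU h⟩) hΩ (hlim U hU)).analyticOnNhd hΩ
  have hU₀ := Ultrafilter.of_le l
  refine ⟨limUnder (Ultrafilter.of l : Filter ι) fun i => F i z, ?_⟩
  rw [tendsto_iff_ultrafilter]
  intro U hU
  -- Two ultrafilter limits are holomorphic and agree wherever the full limit exists, hence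
  -- everywhere on `Ω`.
  have heq := (han U hU).eqOn_of_preconnected_of_frequently_eq (han _ hU₀) hΩc hz₀ (by
    refine hfreq.mono ?_
    rintro w ⟨d, hd⟩
    exact (hd.mono_left hU).limUnder_eq.trans (hd.mono_left hU₀).limUnder_eq.symm)
  have e : limUnder (U : Filter ι) (fun i => F i z) = limUnder _ _ := heq hz
  rw [← e]
  exact hlim U hU z hz

end Vitali

/-! ### Existence, homogeneity and analyticity of the directional derivative. -/

section DirectionalDerivative

variable {φ : C2 → ℂ} {τ : C2}

theorem IsBPoint.norm_eq_one (hB : IsBPoint φ τ) : ‖τ‖ = 1 := norm_eq_one_of_mem_frontier hB.1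

theorem IsBPoint.tendsto_ntNhds (hB : IsBPoint φ τ) (hφ : IsSchur φ) :
    Tendsto φ (ntNhds τ) (𝓝 (ntValue φ τ)) := by
  obtain ⟨ω, V, hV⟩ := hB.exists_isControlled hφ
  exact tendsto_nhds_limUnder ⟨ω, hV.tendsto_ntNhds hφ hB.norm_eq_one⟩

theorem IsBPoint.norm_ntValue (hB : IsBPoint φ τ) (hφ : IsSchur φ) : ‖ntValue φ τ‖ = 1 := by
  obtain ⟨ω, V, hV⟩ := hB.exists_isControlled hφ
  rw [hV.ntValue_eq hφ hB.norm_eq_one]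
  exact hV.norm_eq_one hφ hB.norm_eq_one

theorem IsBPoint.exists_norm_sub_le (hB : IsBPoint φ τ) (hφ : IsSchur φ) (c : ℝ) :
    ∃ K : ℝ, 0 ≤ K ∧ ∀ z ∈ bidisk, ‖τ - z‖ ≤ c * (1 - ‖z‖) →
      ‖ntValue φ τ - φ z‖ ≤ K * (1 - ‖z‖) := by
  obtain ⟨ω, V, hV⟩ := hB.exists_isControlled hφ
  rw [hV.ntValue_eq hφ hB.norm_eq_one]
  exact hV.exists_norm_sub_le hφ hB.norm_eq_one c

theorem diffQuotient_neg (φ : C2 → ℂ) (τ δ : C2) (t : ℝ) :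
    diffQuotient φ τ (-δ) t = (φ (τ - (t : ℂ) • δ) - ntValue φ τ) / (t : ℂ) := by
  rw [diffQuotient, smul_neg, ← sub_eq_add_neg]

/-- The difference quotients are bounded, locally uniformly in the direction. -/
theorem IsBPoint.eventually_norm_diffQuotient_le (hB : IsBPoint φ τ) (hφ : IsSchur φ) {δ : C2}
    (hδ : δ ∈ Htau τ) : ∃ C : ℝ, ∀ᶠ p : C2 × ℝ in 𝓝 δ ×ˢ 𝓝[>] 0,
      τ - (p.2 : ℂ) • p.1 ∈ bidisk ∧ ‖diffQuotient φ τ (-p.1) p.2‖ ≤ C := by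
  have hτ := hB.norm_eq_one
  obtain ⟨κ, hκ0, hκ⟩ := eventually_norm_sub_smul_le hτ hδ
  obtain ⟨K, hK0, hK⟩ := hB.exists_norm_sub_le hφ ((‖δ‖ + 1) / κ)
  refine ⟨K * (‖δ‖ + 1), ?_⟩
  have e1 : ∀ᶠ p : C2 × ℝ in 𝓝 δ ×ˢ 𝓝[>] 0, ‖p.1‖ < ‖δ‖ + 1 := by
    have : ∀ᶠ η in 𝓝 δ, ‖η‖ < ‖δ‖ + 1 :=
      continuous_norm.continuousAt.eventually_lt continuousAt_const (by linarith)
    exact tendsto_fst.eventually this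
  filter_upwards [hκ, e1] with p ⟨hp0, hp⟩ hp1
  obtain ⟨h1, h2⟩ := norm_sub_le_of_norm_sub_smul_le hp0 hκ0 hp
  refine ⟨h1, ?_⟩
  have hz0 : 0 < 1 - ‖τ - (p.2 : ℂ) • p.1‖ := by linarith [mem_bidisk_iff_norm.mp h1]
  have h3 := hK _ h1 (h2.trans (by gcongr))
  rw [diffQuotient_neg, norm_div, Complex.norm_real, Real.norm_of_nonneg hp0.le, div_le_iff₀ hp0,
    norm_sub_rev]
  have h4 : 1 - ‖τ - (p.2 : ℂ) • p.1‖ ≤ p.2 * ‖p.1‖ := by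
    have := norm_sub_norm_le τ (τ - (p.2 : ℂ) • p.1)
    rwa [hτ, sub_sub_cancel, norm_smul, Complex.norm_real, Real.norm_of_nonneg hp0.le] at this
  calc _ ≤ K * (1 - ‖τ - (p.2 : ℂ) • p.1‖) := h3
    _ ≤ K * (p.2 * (‖δ‖ + 1)) := by gcongr; exact h4.trans (by gcongr)
    _ = _ := by ring

theorem isOpen_Htau (τ : C2) : IsOpen (Htau τ) := by
  simp only [Htau, ofPred_forall]
  refine isOpen_iInter_of_finite fun j => isOpen_iInter_of_finite fun _ => ?_
  exact isOpen_lt continuous_const (by fun_prop)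

theorem convex_Htau (τ : C2) : Convex ℝ (Htau τ) := by
  intro x hx y hy a b ha hb hab j hj
  have h1 := hx j hj
  have h2 := hy j hj
  have e : conj (τ j) * (a • x + b • y) j =
      a * (conj (τ j) * x j) + b * (conj (τ j) * y j) := by
    simp only [Pi.add_apply, Pi.smul_apply, Complex.real_smul]; ring
  rw [e, Complex.add_re, Complex.re_ofReal_mul, Complex.re_ofReal_mul]
  rcases ha.eq_or_lt with rfl | ha
  · rw [zero_add] at hab; subst hab; simpa using h2
  · have := mul_nonneg hb h2.le
    have := mul_pos ha h1
    linarith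

/-- The parameters of a complex line for which its points lie in `Htau τ`. -/
def lineDomain (τ a b : C2) : Set ℂ := {w | a + w • b ∈ Htau τ}

theorem isOpen_lineDomain (τ a b : C2) : IsOpen (lineDomain τ a b) :=
  (isOpen_Htau τ).preimage (by fun_prop : Continuous fun w : ℂ => a + w • b)

theorem isPreconnected_lineDomain (τ a b : C2) : IsPreconnected (lineDomain τ a b) := by
  suffices h : Convex ℝ (lineDomain τ a b) from h.isPreconnected
  intro x hx y hy s t hs ht hst
  have h := convex_Htau τ hx hy hs ht hst
  have e : a + (s • x + t • y) • b = s • (a + x • b) + t • (a + y • b) := by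
    have h1 : (s : ℂ) + t = 1 := by rw [← Complex.ofReal_add, hst, Complex.ofReal_one]
    ext j
    simp only [Pi.add_apply, Pi.smul_apply, Complex.real_smul, smul_eq_mul]
    linear_combination (-(a j)) * h1
  change a + (s • x + t • y) • b ∈ Htau τ
  rwa [e]

/-- For fixed `t` the points `τ - t (a + w b)` may leave the bidisk, so holomorphy and bounds hold
only near each `w₀` and for small `t`. -/
theorem IsBPoint.eventuallyLocallyBounded (hB : IsBPoint φ τ) (hφ : IsSchur φ) (a b : C2) :
    EventuallyLocallyBounded (𝓝[>] (0 : ℝ)) (fun t w => diffQuotient φ τ (-(a + w • b)) t)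
      (lineDomain τ a b) := by
  intro w₀ hw₀
  obtain ⟨C, hC⟩ := hB.eventually_norm_diffQuotient_le hφ hw₀
  have hcont : Continuous fun w : ℂ => a + w • b := by fun_prop
  have ht : Tendsto (fun p : ℂ × ℝ => (a + p.1 • b, p.2)) (𝓝 w₀ ×ˢ 𝓝[>] 0)
      (𝓝 (a + w₀ • b) ×ˢ 𝓝[>] 0) := (hcont.tendsto w₀).prodMap tendsto_id
  obtain ⟨pa, hpa, pb, hpb, h⟩ := eventually_prod_iff.mp (ht.eventually hC)
  obtain ⟨r, hr, hrpa⟩ := Metric.eventually_nhds_iff_ball.mp hpa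
  refine ⟨r, hr, C, hpb.mono fun t htb => ⟨fun w hw => ?_, fun w hw => (h (hrpa w hw) htb).2⟩⟩
  have h1 : DifferentiableAt ℂ φ (τ - (t : ℂ) • (a + w • b)) :=
    (hφ.analytic _ (h (hrpa w hw) htb).1).differentiableAt
  have h2 : DifferentiableAt ℂ (fun w : ℂ => τ - (t : ℂ) • (a + w • b)) w := by fun_prop
  have h3 : DifferentiableAt ℂ (fun w : ℂ => φ (τ - (t : ℂ) • (a + w • b))) w :=
    DifferentiableAt.comp w h1 h2
  simp only [diffQuotient_neg]
  exact ((h3.sub_const _).div_const _).differentiableWithinAt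

theorem eventually_forall_norm_sub_lt_one (hτ : ‖τ‖ = 1) {δ : C2} {j : Fin 2}
    (hδ : ‖τ j‖ = 1 → ∃ s : ℝ, 0 < s ∧ δ j = s * τ j) :
    ∀ᶠ R : ℝ in atTop, ∀ z ∈ ball (0 : ℂ) 1, ‖τ j - (1 - z) / (R : ℂ) * δ j‖ < 1 := by
  by_cases hj : ‖τ j‖ = 1
  · obtain ⟨s, hs, hsj⟩ := hδ hj
    filter_upwards [eventually_ge_atTop s] with R hR z hz
    have hR0 : 0 < R := hs.trans_le hR
    have hsR : s / R ≤ 1 := (div_le_one hR0).mpr hR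
    have hsR0 : 0 < s / R := by positivity
    have e : τ j - (1 - z) / (R : ℂ) * δ j = (((1 - s / R : ℝ) : ℂ) + ((s / R : ℝ) : ℂ) * z) * τ j := by
      rw [hsj]; push_cast; ring
    rw [e, norm_mul, hj, mul_one]
    refine (norm_add_le _ _).trans_lt ?_
    rw [norm_mul, Complex.norm_real, Complex.norm_real, Real.norm_of_nonneg (by linarith),
      Real.norm_of_nonneg hsR0.le]
    have := mem_ball_zero_iff.mp hz
    nlinarith
  · have hj' : ‖τ j‖ < 1 := lt_of_le_of_ne (norm_apply_le_one hτ j) hj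
    have hlim : Tendsto (fun R : ℝ => ‖τ j‖ + 2 * ‖δ j‖ / R) atTop (𝓝 (‖τ j‖ + 0)) :=
      (tendsto_const_nhds.div_atTop tendsto_id).const_add _
    rw [add_zero] at hlim
    filter_upwards [hlim.eventually (gt_mem_nhds hj'), eventually_gt_atTop 0] with R hR hR0 z hz
    refine (norm_sub_le _ _).trans_lt (lt_of_le_of_lt ?_ hR)
    rw [norm_mul, norm_div, Complex.norm_real, Real.norm_of_nonneg hR0.le, div_mul_eq_mul_div]
    gcongr
    calc ‖1 - z‖ ≤ ‖(1 : ℂ)‖ + ‖z‖ := norm_sub_le _ _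
      _ ≤ 2 := by rw [norm_one]; linarith [mem_ball_zero_iff.mp hz]

/-- For large `R` the map `z ↦ τ - ((1 - z) / R) δ` sends the disk into the bidisk: at a unimodular
coordinate, `1 - s / R + (s / R) z` is a convex combination of `1` and `z`. The radial theorem
applies to `φ` on this disk. -/
theorem IsBPoint.exists_tendsto_of_radial (hB : IsBPoint φ τ) (hφ : IsSchur φ) {δ : C2}
    (hδ : ∀ j, ‖τ j‖ = 1 → ∃ s : ℝ, 0 < s ∧ δ j = s * τ j) :
    ∃ d, Tendsto (diffQuotient φ τ (-δ)) (𝓝[>] 0) (𝓝 d) := by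
  have hτ := hB.norm_eq_one
  have hδH : δ ∈ Htau τ := fun j hj => by
    obtain ⟨s, hs, hsj⟩ := hδ j hj
    have e : conj (τ j) * (s * τ j) = (s : ℂ) := by
      have : τ j * conj (τ j) = 1 := by rw [Complex.mul_conj, Complex.normSq_eq_norm_sq, hj]; simp
      linear_combination (s : ℂ) * this
    rw [hsj, e]; exact hs
  obtain ⟨R, hR, hR0⟩ := ((eventually_all.mpr fun j =>
    eventually_forall_norm_sub_lt_one hτ (hδ j)).and (eventually_gt_atTop 0)).exists
  have hRC : (R : ℂ) ≠ 0 := Complex.ofReal_ne_zero.mpr hR0.ne'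
  let g : ℂ → C2 := fun z => τ - ((1 - z) / (R : ℂ)) • δ
  have hg : MapsTo g (ball 0 1) bidisk := fun z hz j => hR j z hz
  let f : ℂ → ℂ := fun z => φ (g z)
  have hfd : DifferentiableOn ℂ f (ball 0 1) :=
    hφ.differentiableOn.comp (by fun_prop) hg
  have hval : ∀ t : ℝ, φ (τ - (t : ℂ) • δ) = f ((1 - R * t : ℝ) : ℂ) := fun t => by
    simp only [f, g]
    congr 3
    push_cast
    field_simp
    ring
  obtain ⟨C, hC⟩ := hB.eventually_norm_diffQuotient_le hφ hδH
  have hC' := Eventually.self_of_nhds hC.curry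
  have htr : Tendsto (fun r : ℝ => (1 - r) / R) (𝓝[<] 1) (𝓝[>] 0) := by
    refine tendsto_nhdsWithin_iff.mpr ⟨?_, ?_⟩
    · have h : Continuous fun r : ℝ => (1 - r) / R := by fun_prop
      simpa using (h.tendsto 1).mono_left nhdsWithin_le_nhds
    · filter_upwards [self_mem_nhdsWithin] with r hr
      exact div_pos (sub_pos.mpr hr) hR0
  obtain ⟨d, hd⟩ := exists_tendsto_radial (f := f) (ω := ntValue φ τ) (K := C / R) hfd
    (fun z hz => hφ.norm_le_one _ (hg hz)) (hB.norm_ntValue hφ) (by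
      filter_upwards [htr.eventually hC', htr.eventually self_mem_nhdsWithin] with r hr hr0
      have h1 := hr.2
      have hr0 : 0 < (1 - r) / R := hr0
      rw [diffQuotient_neg, hval, norm_div, Complex.norm_real, Real.norm_of_nonneg hr0.le,
        div_le_iff₀ hr0, show 1 - R * ((1 - r) / R) = r by field_simp; ring, norm_sub_rev] at h1
      exact h1.trans_eq (by ring))
  have htt : Tendsto (fun t : ℝ => 1 - R * t) (𝓝[>] 0) (𝓝[<] 1) := by
    refine tendsto_nhdsWithin_iff.mpr ⟨?_, ?_⟩
    · have h : Continuous fun t : ℝ => 1 - R * t := by fun_prop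
      simpa using (h.tendsto 0).mono_left nhdsWithin_le_nhds
    · filter_upwards [self_mem_nhdsWithin] with t ht
      have := mul_pos hR0 (show (0 : ℝ) < t from ht)
      change 1 - R * t < 1
      linarith
  refine ⟨R * d, ((hd.comp htt).const_mul (R : ℂ)).congr fun t => ?_⟩
  rw [diffQuotient_neg, hval]
  simp only [Function.comp]
  rw [show ((1 - (1 - R * t) : ℝ) : ℂ) = R * t by push_cast; ring, mul_div_assoc',
    mul_div_mul_left _ _ hRC]

theorem update_mem_Htau {η : C2} (hη : η ∈ Htau τ) (j : Fin 2) {s : ℝ} (hs : 0 < s) :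
    Function.update η j (s * τ j) ∈ Htau τ := by
  intro i hi
  by_cases h : i = j
  · subst h
    rw [Function.update_self, show conj (τ i) * (s * τ i) = s * (τ i * conj (τ i)) by ring,
      Complex.mul_conj, Complex.normSq_eq_norm_sq, hi]
    simpa using hs
  · rw [Function.update_of_ne h]
    exact hη i hi

theorem update_eq_add_smul_single (η : C2) (j : Fin 2) (w : ℂ) :
    Function.update η j w = Function.update η j 0 + w • Pi.single j 1 := by
  ext i
  by_cases h : i = j
  · subst h; simp
  · simp [h]

/-- It suffices to know the directional derivatives for the radial values of one coordinate. -/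
theorem IsBPoint.exists_tendsto_of_update (hB : IsBPoint φ τ) (hφ : IsSchur φ) {η : C2}
    (hη : η ∈ Htau τ) {j : Fin 2} (hj : ‖τ j‖ = 1)
    (h : ∀ s : ℝ, 0 < s →
      ∃ d, Tendsto (diffQuotient φ τ (-Function.update η j (s * τ j))) (𝓝[>] 0) (𝓝 d)) :
    ∃ d, Tendsto (diffQuotient φ τ (-η)) (𝓝[>] 0) (𝓝 d) := by
  have hel := hB.eventuallyLocallyBounded hφ (Function.update η j 0) (Pi.single j 1)
  have key := hel.exists_tendsto (isOpen_lineDomain _ _ _) (isPreconnected_lineDomain _ _ _)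
    (z₀ := τ j) (z := η j) ?_ ?_ ?_
  · rw [← update_eq_add_smul_single, Function.update_eq_self] at key
    exact key
  · have := update_mem_Htau hη j one_pos
    rw [Complex.ofReal_one, one_mul, update_eq_add_smul_single] at this
    exact this
  -- The values `s τ j` with `s > 1` accumulate at `τ j`, which is all that Vitali's theorem needs.
  · have ht : Tendsto (fun s : ℝ => (s : ℂ) * τ j) (𝓝[>] 1) (𝓝[≠] τ j) := by
      refine tendsto_nhdsWithin_iff.mpr ⟨?_, ?_⟩
      · have hc : Continuous fun s : ℝ => (s : ℂ) * τ j := by fun_prop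
        simpa using (hc.tendsto 1).mono_left nhdsWithin_le_nhds
      · filter_upwards [self_mem_nhdsWithin] with s hs heq
        have hs : (1 : ℝ) < s := hs
        have h1 := congrArg norm (show (s : ℂ) * τ j = τ j from heq)
        rw [norm_mul, hj, Complex.norm_real, Real.norm_of_nonneg (by linarith)] at h1
        linarith
    refine ht.frequently (Eventually.frequently ?_)
    filter_upwards [self_mem_nhdsWithin] with s hs
    have := h s (one_pos.trans hs)
    rwa [update_eq_add_smul_single] at this
  · change Function.update η j 0 + η j • Pi.single j 1 ∈ Htau τ
    rwa [← update_eq_add_smul_single, Function.update_eq_self]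

theorem IsBPoint.exists_tendsto_diffQuotient (hB : IsBPoint φ τ) (hφ : IsSchur φ) {δ : C2}
    (hδ : δ ∈ Htau τ) : ∃ d, Tendsto (diffQuotient φ τ (-δ)) (𝓝[>] 0) (𝓝 d) := by
  have h1 : ∀ η ∈ Htau τ, (‖τ 1‖ = 1 → ∃ s : ℝ, 0 < s ∧ η 1 = s * τ 1) →
      ∃ d, Tendsto (diffQuotient φ τ (-η)) (𝓝[>] 0) (𝓝 d) := by
    intro η hη hη1
    by_cases h0 : ‖τ 0‖ = 1
    · refine hB.exists_tendsto_of_update hφ hη h0 fun s hs => ?_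
      refine hB.exists_tendsto_of_radial hφ (Fin.forall_fin_two.mpr ⟨fun _ => ⟨s, hs, ?_⟩, ?_⟩)
      · simp
      · simpa using hη1
    · exact hB.exists_tendsto_of_radial hφ (Fin.forall_fin_two.mpr ⟨fun h => absurd h h0, hη1⟩)
  by_cases hτ1 : ‖τ 1‖ = 1
  · refine hB.exists_tendsto_of_update hφ hδ hτ1 fun s hs => h1 _ (update_mem_Htau hδ 1 hs) ?_
    exact fun _ => ⟨s, hs, by simp⟩
  · exact h1 δ hδ fun h => absurd h hτ1

theorem IsBPoint.tendsto_dirDeriv (hB : IsBPoint φ τ) (hφ : IsSchur φ) {δ : C2}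
    (hδ : δ ∈ Htau τ) :
    Tendsto (diffQuotient φ τ (-δ)) (𝓝[>] 0) (𝓝 (dirDeriv φ τ (-δ))) :=
  tendsto_nhds_limUnder (hB.exists_tendsto_diffQuotient hφ hδ)

theorem IsBPoint.differentiableOn_dirDeriv_line (hB : IsBPoint φ τ) (hφ : IsSchur φ) (a b : C2) :
    DifferentiableOn ℂ (fun w => dirDeriv φ τ (-(a + w • b))) (lineDomain τ a b) :=
  (hB.eventuallyLocallyBounded hφ a b).differentiableOn (isOpen_lineDomain _ _ _)
    fun _ hw => hB.tendsto_dirDeriv hφ hw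

theorem IsBPoint.dirDeriv_real_smul (hB : IsBPoint φ τ) (hφ : IsSchur φ) {δ : C2}
    (hδ : δ ∈ Htau τ) {s : ℝ} (hs : 0 < s) (hsδ : (s : ℂ) • δ ∈ Htau τ) :
    dirDeriv φ τ (-((s : ℂ) • δ)) = s * dirDeriv φ τ (-δ) := by
  have ht : Tendsto (fun t : ℝ => t * s) (𝓝[>] 0) (𝓝[>] 0) := by
    refine tendsto_nhdsWithin_iff.mpr ⟨?_, ?_⟩
    · have h : Continuous fun t : ℝ => t * s := by fun_prop
      simpa using (h.tendsto 0).mono_left nhdsWithin_le_nhds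
    · filter_upwards [self_mem_nhdsWithin] with t ht
      exact mul_pos ht hs
  refine tendsto_nhds_unique (hB.tendsto_dirDeriv hφ hsδ)
    ((((hB.tendsto_dirDeriv hφ hδ).comp ht).const_mul (s : ℂ)).congr fun t => ?_)
  have hsC : (s : ℂ) ≠ 0 := Complex.ofReal_ne_zero.mpr hs.ne'
  simp only [Function.comp, diffQuotient_neg, smul_smul, Complex.ofReal_mul]
  rw [mul_div_assoc', mul_comm (t : ℂ), mul_div_mul_left _ _ hsC]

theorem IsBPoint.dirDeriv_smul (hB : IsBPoint φ τ) (hφ : IsSchur φ) {δ : C2}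
    (hδ : δ ∈ Htau τ) {ζ : ℂ} (hζ : ζ • δ ∈ Htau τ) :
    dirDeriv φ τ (-(ζ • δ)) = ζ * dirDeriv φ τ (-δ) := by
  have hmem : ∀ w : ℂ, w ∈ lineDomain τ 0 δ ↔ w • δ ∈ Htau τ := fun w => by
    rw [lineDomain, mem_ofPred_eq, zero_add]
  have hopen := isOpen_lineDomain τ 0 δ
  have h1 : (1 : ℂ) ∈ lineDomain τ 0 δ := by rwa [hmem, one_smul]
  have ht : Tendsto (fun s : ℝ => (s : ℂ)) (𝓝[>] 1) (𝓝[≠] 1) := by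
    refine tendsto_nhdsWithin_iff.mpr ⟨?_, ?_⟩
    · exact (Complex.continuous_ofReal.tendsto 1).mono_left nhdsWithin_le_nhds
    · filter_upwards [self_mem_nhdsWithin] with s hs heq
      exact (ne_of_gt (show (1 : ℝ) < s from hs)) (Complex.ofReal_eq_one.mp heq)
  have key := ((hB.differentiableOn_dirDeriv_line hφ 0 δ).analyticOnNhd
    hopen).eqOn_of_preconnected_of_frequently_eq
    (g := fun w => w * dirDeriv φ τ (-δ))
    ((DifferentiableOn.mul_const differentiableOn_id _).analyticOnNhd hopen)
    (isPreconnected_lineDomain τ 0 δ) h1 (by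
      refine ht.frequently (Eventually.frequently ?_)
      have hev : ∀ᶠ s : ℝ in 𝓝[>] 1, (s : ℂ) ∈ lineDomain τ 0 δ :=
        (ht.mono_right nhdsWithin_le_nhds).eventually (hopen.mem_nhds h1)
      filter_upwards [self_mem_nhdsWithin, hev] with s hs hsm
      rw [zero_add]
      exact hB.dirDeriv_real_smul hφ hδ (one_pos.trans hs) ((hmem _).mp hsm))
  have h2 := key ((hmem ζ).mpr hζ)
  simpa using h2

/-- Homogeneity normalises coordinate `i` to the constant `η i`: near `η` the derivative equals `δ i
/ η i` times a one-variable holomorphic function of `δ k * η i / δ i`. No separate-analyticity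
theorem is needed. -/
theorem IsBPoint.analyticOnNhd_dirDeriv (hB : IsBPoint φ τ) (hφ : IsSchur φ) :
    AnalyticOnNhd ℂ (fun δ => dirDeriv φ τ (-δ)) (Htau τ) := by
  intro η hη
  obtain ⟨i, hi⟩ := exists_norm_apply_eq_one hB.norm_eq_one
  obtain ⟨k, hki, hk⟩ : ∃ k : Fin 2, k ≠ i ∧ ∀ j, j = i ∨ j = k := by
    fin_cases i
    · exact ⟨1, by decide, by decide⟩
    · exact ⟨0, by decide, by decide⟩
  have hηi : η i ≠ 0 := fun h => by
    have := hη i hi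
    rw [h, mul_zero] at this
    exact lt_irrefl _ this
  obtain ⟨h, hh⟩ : ∃ h : ℂ → ℂ,
      ∀ w, h w = dirDeriv φ τ (-(Function.update η k 0 + w • Pi.single k 1)) := ⟨_, fun _ => rfl⟩
  have hline : AnalyticOnNhd ℂ h (lineDomain τ (Function.update η k 0) (Pi.single k 1)) :=
    ((hB.differentiableOn_dirDeriv_line hφ (Function.update η k 0) (Pi.single k 1)).congr
      fun w _ => hh w).analyticOnNhd (isOpen_lineDomain _ _ _)
  have hp : ∀ j : Fin 2, AnalyticAt ℂ (fun δ : C2 => δ j) η := fun j =>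
    (ContinuousLinearMap.proj (R := ℂ) (φ := fun _ : Fin 2 => ℂ) j).analyticAt η
  have hq : AnalyticAt ℂ (fun δ : C2 => δ k * η i / δ i) η :=
    ((hp k).mul analyticAt_const).div (hp i) hηi
  have hq0 : η k * η i / η i = η k := mul_div_cancel_right₀ _ hηi
  have hmem : η k ∈ lineDomain τ (Function.update η k 0) (Pi.single k 1) := by
    rwa [lineDomain, mem_ofPred_eq, ← update_eq_add_smul_single, Function.update_eq_self]
  have hcomp : AnalyticAt ℂ (fun δ : C2 => δ i / η i * h (δ k * η i / δ i)) η :=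
    ((hp i).div analyticAt_const hηi).mul
      (AnalyticAt.comp (g := h) (by rw [hq0]; exact hline _ hmem) hq)
  refine hcomp.congr ?_
  have e2 : ∀ᶠ δ : C2 in 𝓝 η, δ i ≠ 0 := (hp i).continuousAt.eventually_ne hηi
  have e3 : ∀ᶠ δ : C2 in 𝓝 η,
      δ k * η i / δ i ∈ lineDomain τ (Function.update η k 0) (Pi.single k 1) := by
    refine hq.continuousAt.eventually ?_
    simp only [hq0]
    exact (isOpen_lineDomain _ _ _).mem_nhds hmem
  filter_upwards [(isOpen_Htau τ).mem_nhds hη, e2, e3] with δ h1 h2 h3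
  have hδ : (δ i / η i) • (Function.update η k 0 + (δ k * η i / δ i) • Pi.single k 1) = δ := by
    rw [← update_eq_add_smul_single]
    ext j
    rcases hk j with rfl | rfl
    · simp [Function.update_of_ne hki.symm, hηi]
    · simp only [Pi.smul_apply, Function.update_self, smul_eq_mul]
      field_simp
  rw [hh, ← hB.dirDeriv_smul hφ h3 (by rwa [hδ]), hδ]

end DirectionalDerivative

/-! ### Weak compactness of bounded sets in Hilbert space. -/

section WeakCompactness

variable {ι H : Type*} [NormedAddCommGroup H] [InnerProductSpace ℂ H]

/-- `f` converges weakly to `x` along `l`. -/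
def WeakTendsto (f : ι → H) (l : Filter ι) (x : H) : Prop :=
  ∀ v : H, Tendsto (fun i => inner ℂ v (f i)) l (𝓝 (inner ℂ v x))

theorem WeakTendsto.of_tendsto {f : ι → H} {l : Filter ι} {x : H} (h : Tendsto f l (𝓝 x)) :
    WeakTendsto f l x := fun _ => tendsto_const_nhds.inner h

theorem exists_weakTendsto [CompleteSpace H] {U : Ultrafilter ι} {f : ι → H} {C : ℝ}
    (hC : ∀ᶠ i in U, ‖f i‖ ≤ C) : ∃ x, WeakTendsto f U x := by
  have hex : ∀ v : H, ∃ a : ℂ, ‖a‖ ≤ C * ‖v‖ ∧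
      Tendsto (fun i => inner ℂ (f i) v) U (𝓝 a) := by
    intro v
    obtain ⟨a, ha, ha'⟩ := (isCompact_closedBall (0 : ℂ) (C * ‖v‖)).ultrafilter_le_nhds
      (U.map fun i => inner ℂ (f i) v) (by
        rw [le_principal_iff, Ultrafilter.coe_map, mem_map]
        refine hC.mono fun i hi => mem_closedBall_zero_iff.mpr ?_
        exact (norm_inner_le_norm _ _).trans (by gcongr))
    exact ⟨a, mem_closedBall_zero_iff.mp ha, ha'⟩
  choose L hL1 hL2 using hex
  let L' : H →ₗ[ℂ] ℂ :=
    { toFun := L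
      map_add' := fun v w => tendsto_nhds_unique (hL2 (v + w)) (by
        simpa only [inner_add_right] using (hL2 v).add (hL2 w))
      map_smul' := fun c v => tendsto_nhds_unique (hL2 (c • v)) (by
        simpa only [inner_smul_right, RingHom.id_apply, smul_eq_mul] using (hL2 v).const_mul c) }
  refine ⟨(InnerProductSpace.toDual ℂ H).symm (L'.mkContinuous C hL1), fun v => ?_⟩
  have h1 : inner ℂ ((InnerProductSpace.toDual ℂ H).symm (L'.mkContinuous C hL1)) v = L v := by
    rw [InnerProductSpace.toDual_symm_apply]; rfl
  have h2 := (Complex.continuous_conj.tendsto _).comp (hL2 v)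
  rw [← h1, inner_conj_symm] at h2
  exact h2.congr fun i => inner_conj_symm _ _

end WeakCompactness

/-! ### Models: boundary identity, norm limits and the derivative formula. -/

section Model

variable {M : Fin 2 → Type*} [∀ j, NormedAddCommGroup (M j)] [∀ j, InnerProductSpace ℂ (M j)]
variable {φ : C2 → ℂ} {τ δ : C2} {u : C2 → PiLp 2 M}

theorem WeakTendsto.apply {ι : Type*} {f : ι → PiLp 2 M} {l : Filter ι} {x : PiLp 2 M}
    (h : WeakTendsto f l x) (j : Fin 2) (v : M j) :
    Tendsto (fun i => inner ℂ v (f i j)) l (𝓝 (inner ℂ v (x j))) := by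
  have e : ∀ y : PiLp 2 M, inner ℂ (WithLp.toLp 2 (Pi.single j v) : PiLp 2 M) y =
      inner ℂ v (y j) := by
    intro y
    rw [PiLp.inner_apply, Finset.sum_eq_single j]
    · simp
    · intro k _ hk; simp [hk]
    · simp
  simpa only [e] using h (WithLp.toLp 2 (Pi.single j v))

theorem one_sub_norm_sq_pos {z : C2} (hz : z ∈ bidisk) (j : Fin 2) : 0 < 1 - ‖z j‖ ^ 2 := by
  have := pow_lt_one₀ (norm_nonneg _) (hz j) two_ne_zero
  linarith

namespace IsModel

theorem one_sub_norm_sq (hu : IsModel φ u) {z : C2} (hz : z ∈ bidisk) :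
    1 - ‖φ z‖ ^ 2 = ∑ j, (1 - ‖z j‖ ^ 2) * ‖u z j‖ ^ 2 := by
  have h := hu.identity z hz z hz
  have e : ∀ a : ℂ, conj a * a = ((‖a‖ ^ 2 : ℝ) : ℂ) := fun a => by
    rw [mul_comm, Complex.mul_conj, Complex.normSq_eq_norm_sq]
  have e' : ∀ j, inner ℂ (u z j) (u z j) = ((‖u z j‖ ^ 2 : ℝ) : ℂ) := fun j => by
    rw [inner_self_eq_norm_sq_to_K]; norm_cast
  simp only [e, e'] at h
  exact_mod_cast h

theorem one_sub_norm_sq_mul_le (hu : IsModel φ u) {z : C2} (hz : z ∈ bidisk) (j : Fin 2) :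
    (1 - ‖z j‖ ^ 2) * ‖u z j‖ ^ 2 ≤ 1 - ‖φ z‖ ^ 2 := by
  rw [hu.one_sub_norm_sq hz]
  exact Finset.single_le_sum (f := fun j => (1 - ‖z j‖ ^ 2) * ‖u z j‖ ^ 2)
    (fun i _ => mul_nonneg (one_sub_norm_sq_pos hz i).le (by positivity)) (Finset.mem_univ j)

theorem one_sub_norm_mul_le (hu : IsModel φ u) {z : C2} (hz : z ∈ bidisk) :
    (1 - ‖z‖) * ‖u z‖ ^ 2 ≤ 1 - ‖φ z‖ ^ 2 := by
  rw [hu.one_sub_norm_sq hz, PiLp.norm_sq_eq_of_L2, Finset.mul_sum]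
  refine Finset.sum_le_sum fun j _ => mul_le_mul_of_nonneg_right ?_ (by positivity)
  nlinarith [norm_le_pi_norm z j, hz j, norm_nonneg (z j)]

variable {ω : ℂ} {V : Filter C2}

/-- At such a coordinate `1 - |w j|²` stays away from `0`, while `(1 - |w j|²) ‖u w j‖² ≤ 1 - |φ w|²
→ 0`. -/
theorem tendsto_apply_zero (hu : IsModel φ u) [NeBot V] (hφ : IsSchur φ) (hτ : ‖τ‖ = 1)
    (hV : IsControlled φ τ ω V) {j : Fin 2} (hj : ‖τ j‖ ≠ 1) :
    Tendsto (fun w => u w j) V (𝓝 0) := by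
  have hj' : 0 < 1 - ‖τ j‖ ^ 2 := by
    have := pow_lt_one₀ (norm_nonneg _) (lt_of_le_of_ne (norm_apply_le_one hτ j) hj) two_ne_zero
    linarith
  have tj : Tendsto (fun w : C2 => w j) V (𝓝 (τ j)) :=
    ((continuous_apply j).tendsto τ).comp hV.tendsto_id
  have t1 : Tendsto (fun w => (1 - ‖φ w‖ ^ 2) / (1 - ‖w j‖ ^ 2)) V
      (𝓝 ((1 - ‖ω‖ ^ 2) / (1 - ‖τ j‖ ^ 2))) :=
    ((hV.tendsto.norm.pow 2).const_sub 1).div ((tj.norm.pow 2).const_sub 1) hj'.ne'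
  rw [hV.norm_eq_one hφ hτ, one_pow, sub_self, zero_div] at t1
  have t2 : Tendsto (fun w => ‖u w j‖ ^ 2) V (𝓝 0) := by
    refine squeeze_zero' (Eventually.of_forall fun _ => by positivity) ?_ t1
    filter_upwards [hV.eventually_mem] with w hw
    rw [le_div_iff₀ (one_sub_norm_sq_pos hw j), mul_comm]
    exact hu.one_sub_norm_sq_mul_le hw j
  rw [tendsto_zero_iff_norm_tendsto_zero]
  simpa [Real.sqrt_sq (norm_nonneg _)] using t2.sqrt

theorem weakLimit_apply_eq_zero (hu : IsModel φ u) [NeBot V] (hφ : IsSchur φ) (hτ : ‖τ‖ = 1)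
    (hV : IsControlled φ τ ω V) {y : PiLp 2 M} (hy : WeakTendsto u V y) {j : Fin 2}
    (hj : ‖τ j‖ ≠ 1) : y j = 0 := by
  have h1 := hy.apply j (y j)
  have h2 : Tendsto (fun w => inner ℂ (y j) (u w j)) V (𝓝 (inner ℂ (y j) (0 : M j))) :=
    tendsto_const_nhds.inner (hu.tendsto_apply_zero hφ hτ hV hj)
  rw [inner_zero_right] at h2
  exact inner_self_eq_zero.mp (tendsto_nhds_unique h1 h2)

end IsModel

/-- The sesquilinear form `⟨δ x, τ y⟩`, restricted to the coordinates with `|τʲ| = 1`. -/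
noncomputable def boundaryForm (τ δ : C2) (y x : PiLp 2 M) : ℂ :=
  ∑ j with ‖τ j‖ = 1, conj (τ j) * δ j * inner ℂ (y j) (x j)

theorem inner_act_eq_boundaryForm {y : PiLp 2 M} (hy : ∀ j, ‖τ j‖ ≠ 1 → y j = 0)
    (x : PiLp 2 M) : inner ℂ (act τ y) (act δ x) = boundaryForm τ δ y x := by
  rw [boundaryForm, PiLp.inner_apply, Finset.sum_filter]
  refine Finset.sum_congr rfl fun j _ => ?_
  simp only [act, inner_smul_left, inner_smul_right]
  split_ifs with h
  · ring
  · rw [hy j h]; simp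

theorem boundaryForm_self (x : PiLp 2 M) : boundaryForm τ δ x x =
    ∑ j with ‖τ j‖ = 1, conj (τ j) * δ j * ((‖x j‖ ^ 2 : ℝ) : ℂ) := by
  refine Finset.sum_congr rfl fun j _ => ?_
  rw [inner_self_eq_norm_sq_to_K]; norm_cast

theorem boundaryForm_sub_sub (y y' x x' : PiLp 2 M) :
    boundaryForm τ δ (y - y') (x - x') = boundaryForm τ δ y x - boundaryForm τ δ y' x -
      (boundaryForm τ δ y x' - boundaryForm τ δ y' x') := by
  simp only [boundaryForm, ← Finset.sum_sub_distrib]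
  refine Finset.sum_congr rfl fun j _ => ?_
  simp only [PiLp.sub_apply, inner_sub_left, inner_sub_right]
  ring

theorem WeakTendsto.boundaryForm {ι : Type*} {f : ι → PiLp 2 M} {l : Filter ι} {x : PiLp 2 M}
    (h : WeakTendsto f l x) (y : PiLp 2 M) :
    Tendsto (fun i => boundaryForm τ δ y (f i)) l (𝓝 (boundaryForm τ δ y x)) :=
  tendsto_finsetSum _ fun j _ => (h.apply j (y j)).const_mul _

theorem eq_zero_of_boundaryForm_self (hδ : δ ∈ Htau τ) {x : PiLp 2 M}
    (h : boundaryForm τ δ x x = 0) {j : Fin 2} (hj : ‖τ j‖ = 1) : x j = 0 := by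
  rw [boundaryForm_self] at h
  have h1 := congrArg Complex.re h
  rw [Complex.re_sum, Complex.zero_re, Finset.sum_eq_zero_iff_of_nonneg] at h1
  · have h2 := h1 j (by simpa using hj)
    rw [Complex.re_mul_ofReal] at h2
    rcases mul_eq_zero.mp h2 with h3 | h3
    · exact absurd h3 (hδ j hj).ne'
    · simpa using h3
  · intro i hi
    rw [Complex.re_mul_ofReal]
    exact mul_nonneg (hδ i (by simpa using hi)).le (by positivity)

namespace IsModel

variable {ω : ℂ} {V : Filter C2}

/-- The model identity with one of the two points on the boundary. -/
theorem boundary_identity (hu : IsModel φ u) [NeBot V] (hφ : IsSchur φ) (hτ : ‖τ‖ = 1)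
    (hV : IsControlled φ τ ω V) {y : PiLp 2 M} (hy : WeakTendsto u V y) {ζ : ℂ}
    (hz : τ - ζ • δ ∈ bidisk) :
    1 - conj ω * φ (τ - ζ • δ) = ζ * boundaryForm τ δ y (u (τ - ζ • δ)) := by
  set z := τ - ζ • δ
  have t1 : Tendsto (fun w => 1 - conj (φ w) * φ z) V (𝓝 (1 - conj ω * φ z)) :=
    (((Complex.continuous_conj.tendsto ω).comp hV.tendsto).mul_const _).const_sub 1
  have t2 : Tendsto (fun w : C2 => ∑ j, (1 - conj (w j) * z j) * inner ℂ (u w j) (u z j)) V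
      (𝓝 (∑ j, (1 - conj (τ j) * z j) * inner ℂ (y j) (u z j))) := by
    refine tendsto_finsetSum _ fun j _ => Tendsto.mul ?_ ?_
    · have tj : Tendsto (fun w : C2 => w j) V (𝓝 (τ j)) :=
        ((continuous_apply j).tendsto τ).comp hV.tendsto_id
      exact (((Complex.continuous_conj.tendsto _).comp tj).mul_const _).const_sub 1
    · have h := (Complex.continuous_conj.tendsto _).comp (hy.apply j (u z j))
      rw [inner_conj_symm] at h
      exact h.congr fun w => inner_conj_symm _ _
  have h := tendsto_nhds_unique (t1.congr' (by
    filter_upwards [hV.eventually_mem] with w hw using hu.identity z hz w hw)) t2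
  rw [h, boundaryForm, Finset.mul_sum, Finset.sum_filter]
  refine Finset.sum_congr rfl fun j _ => ?_
  split_ifs with hj
  · have h1 : τ j * conj (τ j) = 1 := by
      rw [Complex.mul_conj, Complex.normSq_eq_norm_sq, hj]; simp
    have h2 : z j = τ j - ζ * δ j := rfl
    rw [h2]
    linear_combination (-(inner ℂ (y j) (u z j) : ℂ)) * h1
  · rw [hu.weakLimit_apply_eq_zero hφ hτ hV hy hj, inner_zero_left, mul_zero]

/-- Filters of nontangential approach to a B-point are controlled. -/
theorem isControlled_of_approachesNT (hφ : IsSchur φ) (hB : IsBPoint φ τ)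
    {S : Set C2} (hS : ApproachesNT S τ) (hV : V ≤ 𝓝[S] τ) :
    IsControlled φ τ (ntValue φ τ) V := by
  obtain ⟨hSb, -, c, hc⟩ := id hS
  obtain ⟨K, hK0, hK⟩ := hB.exists_norm_sub_le hφ c
  refine ⟨hV.trans (nhdsWithin_mono _ hSb), ⟨K, ?_⟩,
    (hB.tendsto_ntNhds hφ).mono_left (hV.trans (le_iSup₂_of_le S hS le_rfl))⟩
  filter_upwards [hV self_mem_nhdsWithin] with z hz
  have hz0 : 0 < 1 - ‖z‖ := by linarith [mem_bidisk_iff_norm.mp (hSb hz)]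
  rw [juliaQuotient, div_le_iff₀ hz0]
  have h1 := norm_sub_norm_le (ntValue φ τ) (φ z)
  rw [hB.norm_ntValue hφ] at h1
  exact h1.trans (hK z (hSb hz) (hc z hz))

theorem exists_norm_le_of_approachesNT (hu : IsModel φ u) (hφ : IsSchur φ) (hB : IsBPoint φ τ)
    {S : Set C2} (hS : ApproachesNT S τ) : ∃ C : ℝ, ∀ z ∈ S, ‖u z‖ ≤ C := by
  obtain ⟨hSb, -, c, hc⟩ := hS
  obtain ⟨K, hK0, hK⟩ := hB.exists_norm_sub_le hφ c
  refine ⟨√(2 * K), fun z hz => Real.le_sqrt_of_sq_le ?_⟩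
  have hz0 : 0 < 1 - ‖z‖ := by linarith [mem_bidisk_iff_norm.mp (hSb hz)]
  have h1 := norm_sub_norm_le (ntValue φ τ) (φ z)
  rw [hB.norm_ntValue hφ] at h1
  have h2 := hK z (hSb hz) (hc z hz)
  have h3 := hu.one_sub_norm_mul_le (hSb hz)
  refine le_of_mul_le_mul_left (h3.trans ?_) hz0
  nlinarith [norm_nonneg (φ z), hφ.norm_le_one z (hSb hz)]

/-- The complex parameter of a point on the line through `τ` in the direction `δ`. -/
noncomputable def lineParam (τ δ : C2) (i : Fin 2) (z : C2) : ℂ := (τ i - z i) / δ i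

theorem sub_lineParam_smul {i : Fin 2} (hi : δ i ≠ 0) {z : C2} (hz : ∃ ζ : ℂ, z = τ - ζ • δ) :
    τ - lineParam τ δ i z • δ = z := by
  obtain ⟨ζ, rfl⟩ := hz
  congr 2
  simp [lineParam, hi]

theorem one_sub_norm_sub_mul_sq {a b ζ : ℂ} (ha : ‖a‖ = 1) :
    1 - ‖a - ζ * b‖ ^ 2 = 2 * (ζ * (conj a * b)).re - ‖ζ‖ ^ 2 * ‖b‖ ^ 2 := by
  have h : ‖a‖ ^ 2 = 1 := by rw [ha, one_pow]
  rw [← h]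
  simp only [← Complex.normSq_eq_norm_sq, Complex.normSq_apply, Complex.sub_re, Complex.sub_im,
    Complex.mul_re, Complex.mul_im, Complex.conj_re, Complex.conj_im]
  ring

/-- Along ultrafilters of nontangential approach in a fixed complex direction, weak limits of the
model are norm limits. -/
theorem tendsto_of_weakTendsto (hu : IsModel φ u) (hφ : IsSchur φ) (hB : IsBPoint φ τ)
    (hδ : δ ∈ Htau τ) {S : Set C2} (hS : ApproachesNT S τ) {U : Ultrafilter C2}
    (hU : (U : Filter C2) ≤ 𝓝[S] τ) (hUT : ∀ᶠ z in U, ∃ ζ : ℂ, z = τ - ζ • δ) {x : PiLp 2 M}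
    (hx : WeakTendsto u U x) : Tendsto u U (𝓝 x) := by
  have hτ := hB.norm_eq_one
  have hV := isControlled_of_approachesNT hφ hB hS hU
  set ω := ntValue φ τ
  have hω : ‖ω‖ = 1 := hB.norm_ntValue hφ
  obtain ⟨hSb, -, c₀, hc₀⟩ := hS
  obtain ⟨i, hi⟩ := exists_norm_apply_eq_one hτ
  have hδi : δ i ≠ 0 := fun h => by
    have := hδ i hi
    rw [h, mul_zero] at this
    exact lt_irrefl _ this
  set c := max c₀ 1
  have hc0 : 0 < c := one_pos.trans_le (le_max_right _ _)
  set ζ : C2 → ℂ := lineParam τ δ i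
  have hζlim : Tendsto ζ U (𝓝 0) := by
    have h1 : Continuous ζ := by
      change Continuous fun z : C2 => (τ i - z i) / δ i
      fun_prop
    have h2 : Tendsto ζ U (𝓝 (ζ τ)) := (h1.tendsto τ).comp hV.tendsto_id
    simpa [ζ, lineParam] using h2
  have hall : ∀ᶠ z in U, z ∈ bidisk ∧ τ - ζ z • δ = z ∧ 0 < ‖ζ z‖ ∧
      ‖ζ z‖ * ‖δ i‖ ≤ c * (1 - ‖z‖) := by
    filter_upwards [hU self_mem_nhdsWithin, hUT] with z hzS hzT
    have h1 : τ - ζ z • δ = z := sub_lineParam_smul hδi hzT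
    have hzb := hSb hzS
    have hz0 : 0 < 1 - ‖z‖ := by linarith [mem_bidisk_iff_norm.mp hzb]
    refine ⟨hzb, h1, norm_pos_iff.mpr fun h0 => ?_, ?_⟩
    · rw [h0, zero_smul, sub_zero] at h1
      rw [← h1, hτ] at hz0
      linarith
    · have h2 : ‖(τ - z) i‖ ≤ ‖τ - z‖ := norm_le_pi_norm _ i
      have h3 : (τ - z) i = ζ z * δ i := by
        have : τ - z = ζ z • δ := by rw [sub_eq_iff_eq_add, ← sub_eq_iff_eq_add', h1]
        rw [this]; rfl
      rw [h3, norm_mul] at h2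
      refine h2.trans ((hc₀ z hzS).trans ?_)
      gcongr
      exact le_max_left _ _
  -- `ζ` may approach `0` from varying directions; along the ultrafilter its argument converges to
  -- that of a limit `η`.
  obtain ⟨η, -, hη⟩ := (isCompact_closedBall (0 : ℂ) 1).ultrafilter_le_nhds
    (U.map fun z => ζ z / ((‖ζ z‖ : ℝ) : ℂ)) (by
      rw [le_principal_iff, Ultrafilter.coe_map, mem_map]
      filter_upwards [hall] with z hz
      change ζ z / ((‖ζ z‖ : ℝ) : ℂ) ∈ closedBall (0 : ℂ) 1
      rw [mem_closedBall_zero_iff, norm_div, Complex.norm_real, norm_norm, div_self hz.2.2.1.ne'])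
  have hη' : Tendsto (fun z => ζ z / ((‖ζ z‖ : ℝ) : ℂ)) U (𝓝 η) := hη
  set q : Fin 2 → C2 → ℝ := fun j z => (1 - ‖z j‖ ^ 2) / (2 * ‖ζ z‖)
  set ρ : Fin 2 → ℝ := fun j => (η * (conj (τ j) * δ j)).re
  have hqlim : ∀ j, ‖τ j‖ = 1 → Tendsto (q j) U (𝓝 (ρ j)) := by
    intro j hj
    have h1 : Tendsto (fun z => ((ζ z / ((‖ζ z‖ : ℝ) : ℂ)) * (conj (τ j) * δ j)).re -
        ‖ζ z‖ * ‖δ j‖ ^ 2 / 2) U (𝓝 (ρ j - ‖(0 : ℂ)‖ * ‖δ j‖ ^ 2 / 2)) :=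
      ((Complex.continuous_re.tendsto _).comp (hη'.mul_const _)).sub
        ((hζlim.norm.mul_const _).div_const 2)
    rw [norm_zero, zero_mul, zero_div, sub_zero] at h1
    refine h1.congr' ?_
    filter_upwards [hall] with z hz
    have h2 : z j = τ j - ζ z * δ j := (congrFun hz.2.1 j).symm
    have h3 := hz.2.2.1
    simp only [q]
    rw [h2, one_sub_norm_sub_mul_sq hj, div_mul_eq_mul_div, Complex.div_ofReal_re]
    field_simp
  -- Nontangential approach makes `1 - ‖z‖` at least a multiple of `|ζ z|`, so the weights do not
  -- degenerate.
  have hqlow : ∀ᶠ z in U, ∀ j, ‖δ i‖ / (2 * c) ≤ q j z := by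
    filter_upwards [hall] with z hz j
    have h1 : 1 - ‖z‖ ≤ 1 - ‖z j‖ ^ 2 := by
      nlinarith [norm_le_pi_norm z j, hz.1 j, norm_nonneg (z j)]
    have h2 : c * (1 - ‖z‖) ≤ c * (1 - ‖z j‖ ^ 2) := by gcongr
    have h3 := hz.2.2.1
    rw [div_le_div_iff₀ (by positivity) (by positivity)]
    linarith [hz.2.2.2]
  -- `E` bounds the weighted square distance from `u z` to `x`: expand the square and replace the
  -- weighted norm of `u z` by its bound from the boundary identity. It is affine in `u z`, so weak
  -- convergence suffices to compute its limit, `0`.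
  set E : C2 → ℝ := fun z =>
    ((ζ z / ((‖ζ z‖ : ℝ) : ℂ)) * boundaryForm τ δ x (u z)).re +
      ∑ j with ‖τ j‖ = 1, q j z * (‖x j‖ ^ 2 - 2 * (inner ℂ (x j) (u z j) : ℂ).re)
  have hElim : Tendsto E U (𝓝 0) := by
    have h1 : Tendsto E U (𝓝 ((η * boundaryForm τ δ x x).re + ∑ j with ‖τ j‖ = 1,
        ρ j * (‖x j‖ ^ 2 - 2 * (inner ℂ (x j) (x j) : ℂ).re))) := by
      refine ((Complex.continuous_re.tendsto _).comp (hη'.mul (hx.boundaryForm x))).add ?_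
      refine tendsto_finsetSum _ fun j hj => (hqlim j (by simpa using hj)).mul ?_
      exact (((Complex.continuous_re.tendsto _).comp (hx.apply j (x j))).const_mul 2).const_sub _
    convert h1 using 2
    rw [boundaryForm_self, Finset.mul_sum, Complex.re_sum, ← Finset.sum_add_distrib]
    refine (Finset.sum_eq_zero fun j _ => ?_).symm
    have h2 : (inner ℂ (x j) (x j) : ℂ).re = ‖x j‖ ^ 2 := by
      rw [inner_self_eq_norm_sq_to_K]; norm_cast
    rw [h2, ← mul_assoc, Complex.re_mul_ofReal]
    ring
  have hEle : ∀ᶠ z in U, ∑ j with ‖τ j‖ = 1, q j z * ‖u z j - x j‖ ^ 2 ≤ E z := by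
    filter_upwards [hall] with z ⟨hzb, hzζ, hζ0, _⟩
    have hid := hu.boundary_identity hφ hτ hV hx (δ := δ) (ζ := ζ z) (by rwa [hzζ])
    rw [hzζ] at hid
    have h1 : ∑ j with ‖τ j‖ = 1, (1 - ‖z j‖ ^ 2) * ‖u z j‖ ^ 2 ≤ 1 - ‖φ z‖ ^ 2 := by
      rw [hu.one_sub_norm_sq hzb]
      exact Finset.sum_le_sum_of_subset_of_nonneg (Finset.filter_subset _ _)
        fun j _ _ => mul_nonneg (one_sub_norm_sq_pos hzb j).le (by positivity)
    -- This is `1 - |a|² ≤ 2 Re (1 - a)` for `a = conj ω * φ z`.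
    have h2 : 1 - ‖φ z‖ ^ 2 ≤ 2 * (ζ z * boundaryForm τ δ x (u z)).re := by
      rw [← hid]
      have h3 := norm_one_sub_conj_mul_sq ω (φ z)
      have h4 : ‖1 - conj ω * φ z‖ ^ 2 = 1 - 2 * (conj ω * φ z).re + ‖φ z‖ ^ 2 := by
        have h5 : ‖conj ω * φ z‖ ^ 2 = ‖φ z‖ ^ 2 := by
          rw [norm_mul, RCLike.norm_conj, hω, one_mul]
        rw [← h5]
        simp only [← Complex.normSq_eq_norm_sq, Complex.normSq_apply, Complex.sub_re,
          Complex.sub_im, Complex.one_re, Complex.one_im]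
        ring
      rw [Complex.sub_re, Complex.one_re]
      nlinarith [sq_nonneg ‖1 - conj ω * φ z‖]
    have h6 : ∑ j with ‖τ j‖ = 1, q j z * ‖u z j‖ ^ 2 ≤
        ((ζ z / ((‖ζ z‖ : ℝ) : ℂ)) * boundaryForm τ δ x (u z)).re := by
      rw [div_mul_eq_mul_div, Complex.div_ofReal_re, le_div_iff₀ hζ0, Finset.sum_mul]
      have h7 : ∑ j with ‖τ j‖ = 1, q j z * ‖u z j‖ ^ 2 * ‖ζ z‖ =
          (∑ j with ‖τ j‖ = 1, (1 - ‖z j‖ ^ 2) * ‖u z j‖ ^ 2) / 2 := by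
        rw [Finset.sum_div]
        refine Finset.sum_congr rfl fun j _ => ?_
        simp only [q]
        field_simp
      rw [h7]
      linarith
    have h8 : ∑ j with ‖τ j‖ = 1, q j z * ‖u z j - x j‖ ^ 2 =
        ∑ j with ‖τ j‖ = 1, q j z * ‖u z j‖ ^ 2 +
        ∑ j with ‖τ j‖ = 1, q j z * (‖x j‖ ^ 2 - 2 * (inner ℂ (x j) (u z j) : ℂ).re) := by
      rw [← Finset.sum_add_distrib]
      refine Finset.sum_congr rfl fun j _ => ?_
      rw [norm_sub_rev, @norm_sub_sq ℂ]
      simp only [RCLike.re_to_complex]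
      ring
    rw [h8]
    exact add_le_add_left h6 _
  have hcomp : ∀ j, Tendsto (fun z => ‖u z j - x j‖ ^ 2) U (𝓝 0) := by
    intro j
    by_cases hj : ‖τ j‖ = 1
    · have hκ : 0 < ‖δ i‖ / (2 * c) := div_pos (norm_pos_iff.mpr hδi) (by positivity)
      have h1 : Tendsto (fun z => E z / (‖δ i‖ / (2 * c))) U (𝓝 0) := by
        simpa using hElim.div_const (‖δ i‖ / (2 * c))
      refine squeeze_zero' (Eventually.of_forall fun _ => by positivity) ?_ h1
      filter_upwards [hqlow, hEle] with z hz1 hz2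
      rw [le_div_iff₀ hκ, mul_comm]
      refine le_trans ?_ hz2
      refine le_trans (mul_le_mul_of_nonneg_right (hz1 j) (by positivity)) ?_
      exact Finset.single_le_sum (f := fun j => q j z * ‖u z j - x j‖ ^ 2)
        (fun k _ => mul_nonneg (hκ.le.trans (hz1 k)) (by positivity)) (by simpa using hj)
    · have h1 := hu.tendsto_apply_zero hφ hτ hV hj
      rw [hu.weakLimit_apply_eq_zero hφ hτ hV hx hj]
      simpa using h1.norm.pow 2
  rw [tendsto_iff_norm_sub_tendsto_zero]
  have h1 : Tendsto (fun z => ‖u z - x‖ ^ 2) U (𝓝 0) := by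
    have h2 : Tendsto (fun z => ∑ j, ‖u z j - x j‖ ^ 2) U (𝓝 (∑ _j : Fin 2, (0 : ℝ))) :=
      tendsto_finsetSum _ fun j _ => hcomp j
    rw [Finset.sum_const_zero] at h2
    exact h2.congr fun z => by rw [PiLp.norm_sq_eq_of_L2]; rfl
  simpa [Real.sqrt_sq (norm_nonneg _)] using h1.sqrt

/-- The norm limit does not depend on the ultrafilter. -/
theorem limit_unique (hu : IsModel φ u) (hφ : IsSchur φ) (hτ : ‖τ‖ = 1)
    (hδ : δ ∈ Htau τ) {U V : Filter C2} [NeBot U] [NeBot V] (hU : IsControlled φ τ ω U)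
    (hV : IsControlled φ τ ω V) (hUT : ∀ᶠ z in U, ∃ ζ : ℂ, z = τ - ζ • δ)
    (hVT : ∀ᶠ z in V, ∃ ζ : ℂ, z = τ - ζ • δ) {x y : PiLp 2 M}
    (hx : WeakTendsto u U x) (hy : WeakTendsto u V y) : x = y := by
  have key : ∀ {W : Filter C2} [NeBot W], IsControlled φ τ ω W →
      (∀ᶠ z in W, ∃ ζ : ℂ, z = τ - ζ • δ) → ∀ {w : PiLp 2 M}, WeakTendsto u W w →
      boundaryForm τ δ x w = boundaryForm τ δ y w := by
    intro W _ hW hWT w hw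
    refine tendsto_nhds_unique ((hw.boundaryForm x).congr' ?_) (hw.boundaryForm y)
    filter_upwards [hW.eventually_mem, hWT] with z hzb ⟨ζ, hζ⟩
    subst hζ
    have hζ0 : ζ ≠ 0 := by
      rintro rfl
      rw [zero_smul, sub_zero] at hzb
      exact absurd hτ (mem_bidisk_iff_norm.mp hzb).ne
    exact mul_left_cancel₀ hζ0 ((hu.boundary_identity hφ hτ hU hx hzb).symm.trans
      (hu.boundary_identity hφ hτ hV hy hzb))
  -- Both `x` and `y` represent the same function of `z` in the boundary identity, so the forms
  -- against them agree at either limit.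
  have h0 : boundaryForm τ δ (x - y) (x - y) = 0 := by
    rw [boundaryForm_sub_sub, key hU hUT hx, key hV hVT hy]
    ring
  rw [← sub_eq_zero]
  ext j
  by_cases hj : ‖τ j‖ = 1
  · exact eq_zero_of_boundaryForm_self hδ h0 hj
  · rw [PiLp.sub_apply, hu.weakLimit_apply_eq_zero hφ hτ hU hx hj,
      hu.weakLimit_apply_eq_zero hφ hτ hV hy hj, sub_zero]; rfl

/-- An ultrafilter below a supremum of infinitely many filters need not lie below one of them.
Convergence is therefore tested on each `S` separately, where the aperture is fixed. -/
theorem ntNhdsAlong_eq_iSup (τ δ : C2) : ntNhdsAlong τ δ =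
    ⨆ (S : Set C2) (_ : ApproachesNT S τ), 𝓝[S] τ ⊓ 𝓟 {z | ∃ ζ : ℂ, z = τ - ζ • δ} := by
  simp only [ntNhdsAlong, ntNhds, ← iSup_inf_principal]

theorem exists_ultrafilter_ntNhdsAlong (hτ : ‖τ‖ = 1) (hδ : δ ∈ Htau τ) :
    ∃ S, ApproachesNT S τ ∧ ∃ U : Ultrafilter C2, (U : Filter C2) ≤ 𝓝[S] τ ∧
      (∀ᶠ z in U, ∃ ζ : ℂ, z = τ - ζ • δ) ∧ (U : Filter C2) ≤ ntNhdsAlong τ δ := by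
  have h := neBot_ntNhdsAlong hτ hδ
  rw [ntNhdsAlong_eq_iSup, iSup_neBot] at h
  obtain ⟨S, h⟩ := h
  rw [iSup_neBot] at h
  obtain ⟨hS, h⟩ := h
  have hU := Ultrafilter.of_le (𝓝[S] τ ⊓ 𝓟 {z | ∃ ζ : ℂ, z = τ - ζ • δ})
  refine ⟨S, hS, Ultrafilter.of _, hU.trans inf_le_left,
    le_principal_iff.mp (hU.trans inf_le_right), hU.trans ?_⟩
  rw [ntNhdsAlong_eq_iSup]
  exact le_iSup₂_of_le S hS le_rfl

theorem tendsto_xtau [∀ j, CompleteSpace (M j)] (hu : IsModel φ u) (hφ : IsSchur φ)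
    (hB : IsBPoint φ τ) (hδ : δ ∈ Htau τ) :
    Tendsto u (ntNhdsAlong τ δ) (𝓝 (xtau u τ δ)) := by
  have hτ := hB.norm_eq_one
  have hex : ∀ {S : Set C2} {U : Ultrafilter C2}, ApproachesNT S τ → (U : Filter C2) ≤ 𝓝[S] τ →
      (∀ᶠ z in U, ∃ ζ : ℂ, z = τ - ζ • δ) → ∃ x, Tendsto u U (𝓝 x) := by
    intro S U hS hU hUT
    obtain ⟨C, hC⟩ := hu.exists_norm_le_of_approachesNT hφ hB hS
    obtain ⟨x, hx⟩ := exists_weakTendsto (U := U) (f := u) (C := C) (by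
      filter_upwards [hU self_mem_nhdsWithin] with z hz using hC z hz)
    exact ⟨x, hu.tendsto_of_weakTendsto hφ hB hδ hS hU hUT hx⟩
  obtain ⟨S₀, hS₀, U₀, hU₀, hU₀T, -⟩ := exists_ultrafilter_ntNhdsAlong hτ hδ
  obtain ⟨x₀, hx₀⟩ := hex hS₀ hU₀ hU₀T
  refine tendsto_nhds_limUnder ⟨x₀, ?_⟩
  rw [ntNhdsAlong_eq_iSup, tendsto_iSup]
  intro S
  rw [tendsto_iSup]
  intro hS
  rw [tendsto_iff_ultrafilter]
  intro U hU
  have hU1 := hU.trans inf_le_left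
  have hUT : ∀ᶠ z in (U : Filter C2), ∃ ζ : ℂ, z = τ - ζ • δ :=
    le_principal_iff.mp (hU.trans inf_le_right)
  obtain ⟨x, hx⟩ := hex hS hU1 hUT
  rwa [← hu.limit_unique hφ hτ hδ (isControlled_of_approachesNT hφ hB hS hU1)
    (isControlled_of_approachesNT hφ hB hS₀ hU₀) hUT hU₀T (.of_tendsto hx)
    (.of_tendsto hx₀)]

theorem dirDeriv_eq [∀ j, CompleteSpace (M j)] (hu : IsModel φ u) (hφ : IsSchur φ)
    (hB : IsBPoint φ τ) (hδ : δ ∈ Htau τ) [NeBot V] (hV : IsControlled φ τ (ntValue φ τ) V)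
    {y : PiLp 2 M} (hy : WeakTendsto u V y) :
    dirDeriv φ τ (-δ) = -(ntValue φ τ) * boundaryForm τ δ y (xtau u τ δ) := by
  have hτ := hB.norm_eq_one
  have ht := (hu.tendsto_xtau hφ hB hδ).comp (tendsto_ray hτ hδ)
  refine tendsto_nhds_unique (hB.tendsto_dirDeriv hφ hδ)
    ((((WeakTendsto.of_tendsto ht).boundaryForm y).const_mul _).congr' ?_)
  obtain ⟨κ, hκ0, hκ⟩ := eventually_norm_sub_smul_le hτ hδ
  have hκ' := Eventually.self_of_nhds hκ.curry
  filter_upwards [hκ'] with t ⟨ht0, ht1⟩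
  have hb := (norm_sub_le_of_norm_sub_smul_le ht0 hκ0 ht1).1
  have hid := hu.boundary_identity hφ hτ hV hy hb
  have h1 : ntValue φ τ * conj (ntValue φ τ) = 1 := by
    rw [Complex.mul_conj, Complex.normSq_eq_norm_sq, hB.norm_ntValue hφ]; simp
  have ht0C : (t : ℂ) ≠ 0 := Complex.ofReal_ne_zero.mpr ht0.ne'
  rw [diffQuotient_neg, eq_div_iff ht0C, Function.comp]
  linear_combination (ntValue φ τ) * hid + φ (τ - (t : ℂ) • δ) * h1

/-- The sequences in the definition of `Ytau` are controlled. -/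
theorem isControlled_of_seq (hφ : IsSchur φ) (hB : IsBPoint φ τ) {z : ℕ → C2}
    (hz : ∀ n, z n ∈ bidisk) (hzτ : Tendsto z atTop (𝓝 τ))
    (hC : ∃ C : ℝ, ∀ n, juliaQuotient φ (z n) ≤ C) :
    IsControlled φ τ (ntValue φ τ) (map z atTop) := by
  obtain ⟨C, hC⟩ := hC
  have hle : map z atTop ≤ 𝓝[bidisk] τ :=
    tendsto_nhdsWithin_iff.mpr ⟨hzτ, Eventually.of_forall hz⟩
  have hbd : ∀ᶠ w in map z atTop, juliaQuotient φ w ≤ C :=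
    eventually_map.mpr (Eventually.of_forall hC)
  refine ⟨hle, ⟨C, hbd⟩, ?_⟩
  rw [tendsto_iff_ultrafilter]
  intro U hU
  -- Convergence of `φ` along the sequence is not assumed: any ultrafilter limit comes from a
  -- controlled filter and so equals the nontangential value.
  obtain ⟨ω, -, hω⟩ := (isCompact_closedBall (0 : ℂ) 1).ultrafilter_le_nhds (U.map φ) (by
    rw [le_principal_iff, Ultrafilter.coe_map, mem_map]
    filter_upwards [hU (hle self_mem_nhdsWithin)] with w hw
    simpa using hφ.norm_le_one w hw)
  have hV : IsControlled φ τ ω U := ⟨hU.trans hle, ⟨C, hU hbd⟩, hω⟩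
  rw [hV.ntValue_eq hφ hB.norm_eq_one]
  exact hω

end IsModel

end Model

end Bidisk

theorem mainTheorem2 (φ : Bidisk.C2 → ℂ) (hφ : Bidisk.IsSchur φ)
    (τ : Bidisk.C2) (hτ : Bidisk.IsBPoint φ τ) :
    -- the boundary value `φ(τ)` exists
    Tendsto φ (Bidisk.ntNhds τ) (𝓝 (Bidisk.ntValue φ τ)) ∧
    -- the directional derivatives exist
    (∀ δ ∈ Bidisk.Htau τ,
      Tendsto (Bidisk.diffQuotient φ τ (-δ)) (𝓝[>] (0 : ℝ)) (𝓝 (Bidisk.dirDeriv φ τ (-δ)))) ∧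
    -- analyticity in `δ`
    AnalyticOnNhd ℂ (fun δ => Bidisk.dirDeriv φ τ (-δ)) (Bidisk.Htau τ) ∧
    -- homogeneity of degree 1 in `δ`
    (∀ δ ∈ Bidisk.Htau τ, ∀ ζ : ℂ, ζ • δ ∈ Bidisk.Htau τ →
      Bidisk.dirDeriv φ τ (-(ζ • δ)) = ζ * Bidisk.dirDeriv φ τ (-δ)) ∧
    -- the formulas, for every model
    (∀ (M : Fin 2 → Type*) [∀ j, NormedAddCommGroup (M j)] [∀ j, InnerProductSpace ℂ (M j)]
      [∀ j, CompleteSpace (M j)] (u : Bidisk.C2 → PiLp 2 M), Bidisk.IsModel φ u →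
      ∀ δ ∈ Bidisk.Htau τ,
        Tendsto u (Bidisk.ntNhdsAlong τ δ) (𝓝 (Bidisk.xtau u τ δ)) ∧
        (∀ y ∈ Bidisk.Ytau φ u τ,
          Bidisk.dirDeriv φ τ (-δ) =
            -(Bidisk.ntValue φ τ) *
              inner ℂ (Bidisk.act τ y) (Bidisk.act δ (Bidisk.xtau u τ δ))) ∧
        Bidisk.dirDeriv φ τ (-δ) =
          -(Bidisk.ntValue φ τ) *
            ∑ j with ‖τ j‖ = 1,
              starRingEnd ℂ (τ j) * δ j * ((‖Bidisk.xtau u τ δ j‖ ^ 2 : ℝ) : ℂ)) := by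
  refine ⟨hτ.tendsto_ntNhds hφ, fun δ hδ => hτ.tendsto_dirDeriv hφ hδ,
    hτ.analyticOnNhd_dirDeriv hφ, fun δ hδ ζ hζ => hτ.dirDeriv_smul hφ hδ hζ, ?_⟩
  intro M _ _ _ u hu δ hδ
  have hx := hu.tendsto_xtau hφ hτ hδ
  refine ⟨hx, ?_, ?_⟩
  · rintro y ⟨z, hz, hzτ, hC, hy⟩
    have hV := Bidisk.IsModel.isControlled_of_seq hφ hτ hz hzτ hC
    have hy' : Bidisk.WeakTendsto u (map z atTop) y := fun v => tendsto_map'_iff.mpr (hy v)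
    rw [Bidisk.inner_act_eq_boundaryForm fun j hj =>
      hu.weakLimit_apply_eq_zero hφ hτ.norm_eq_one hV hy' hj]
    exact hu.dirDeriv_eq hφ hτ hδ hV hy'
  -- The norm limit in the direction `δ` is itself a weak limit along a controlled filter, so it may
  -- serve as `y`.
  · obtain ⟨S, hS, U, hU, -, hUle⟩ :=
      Bidisk.IsModel.exists_ultrafilter_ntNhdsAlong hτ.norm_eq_one hδ
    rw [← Bidisk.boundaryForm_self]
    exact hu.dirDeriv_eq hφ hτ hδ (Bidisk.IsModel.isControlled_of_approachesNT hφ hτ hS hU)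
      (.of_tendsto (hx.mono_left hUle))
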